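/- Let $K$ be a finite-dimensional complex Hilbert space (inner product linear in the second argument) with a complex conjugation $J$, i.e. an antilinear map with $J^2=1$ and $\langle Jf,Jg\rangle=\langle g,f\rangle$. Let $\mathfrak A=\mathrm{CAR}(K,J)$ be the selfdual CAR algebra: the complex $*$-algebra generated by elements $B(f)$, $f\in K$, linear in $f$, with $B(f)^*=B(Jf)$ and $B(f)B(h)+B(h)B(f)=\langle Jf,h\rangle 1$. A covariance operator is a linear operator $S$ on $K$ with $0\le S\le 1$ and $S+JSJ=1$; a basis projection is a covariance operator $P$ with $P^2=P$. The quasifree state $\omega_S$ with covariance operator $S$ is the state on $\mathfrak A$ with two-point function $\omega_S(B(f)B(h))=\langle Jf,Sh\rangle$ whose other correlation functions are given by Wick's theorem: those of odd order vanish, and $\omega_S(B(f_1)\cdots B(f_{2n}))=\sum_{j=2}^{2n}(-1)^j\langle Jf_1,Sf_j\rangle\,\omega_S\big(\prod_{i\ne 1,j}B(f_i)\big)$. Let $\mathrm{tr}$ be a faithful trace on $\mathfrak A$ and $\langle V,W\rangle=\mathrm{tr}(V^*W)$ for $V,W\in\mathfrak A$. For a state $\omega$ on $\mathfrak A$ let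 $\mathcal S(\omega)$ be the set of all $V\in\mathfrak A$ with $\omega(A)=\langle V,AV\rangle$ for all $A\in\mathfrak A$. The fidelity of two states is $F(\omega,\varphi)=\sup\{|\langle V,W\rangle| : V\in\mathcal S(\omega),\ W\in\mathcal S(\varphi)\}$. Theorem. Let $P$ be a basis projection and $S$ a covariance operator on $K$. Then $\omega_P$ and $\omega_S$ are states, the set defining $F(\omega_P,\omega_S)$ is non-empty and bounded above, and $$F(\omega_P,\omega_S)^2=|\det(1-P-S)|^{1/2}.$$ -/

import Mathlib

open scoped InnerProductSpace ComplexOrder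

noncomputable section

namespace SelfDualCAR

/-- A complex conjugation on a Hilbert space: an antilinear, antiunitary involution.
(Mathlib's inner product is antilinear in the first argument.) -/
structure Conjugation (K : Type*) [NormedAddCommGroup K] [InnerProductSpace ℂ K] where
  /-- the underlying antilinear map -/
  toMap : K →ₗ⋆[ℂ] K
  involutive : ∀ f, toMap (toMap f) = f
  inner_map_map : ∀ f g, ⟪toMap f, toMap g⟫_ℂ = ⟪g, f⟫_ℂ

section CAR

variable {K : Type*} [NormedAddCommGroup K] [InnerProductSpace ℂ K]

/-- The complex bilinear form `(f, h) ↦ ⟪J f, T h⟫`. -/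
def pairing (J : Conjugation K) (T : K →ₗ[ℂ] K) : LinearMap.BilinForm ℂ K :=
  LinearMap.mk₂ ℂ (fun f h => ⟪J.toMap f, T h⟫_ℂ)
    (fun f g h => by rw [map_add, inner_add_left])
    (fun c f h => by simp [mul_comm])
    (fun f g h => by rw [map_add, inner_add_right])
    (fun c f h => by rw [map_smul, inner_smul_right, smul_eq_mul])

@[simp]
theorem pairing_apply (J : Conjugation K) (T : K →ₗ[ℂ] K) (f h : K) :
    pairing J T f h = ⟪J.toMap f, T h⟫_ℂ := rfl

/-- The quadratic form `f ↦ ⟪J f, f⟫ / 2`. -/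
def carForm (J : Conjugation K) : QuadraticForm ℂ K :=
  ((1 / 2 : ℂ) • pairing J LinearMap.id).toQuadraticMap

theorem carForm_apply (J : Conjugation K) (f : K) :
    carForm J f = 1 / 2 * ⟪J.toMap f, f⟫_ℂ := by
  simp [carForm]

/-- The selfdual CAR algebra over `(K, J)`: the complex algebra generated by elements `B f`, linear
in `f`, with `B f * B h + B h * B f = ⟪J f, h⟫`; equivalently (polarize) `B f ^ 2 = ⟪J f, f⟫ / 2`,
so it is a Clifford algebra. For finite-dimensional `K` it is finite-dimensional, and no completion
is needed. Its adjoint is the instance `instStarRing` below. -/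
def CAR (J : Conjugation K) : Type _ := CliffordAlgebra (carForm J)

instance (J : Conjugation K) : Ring (CAR J) := inferInstanceAs (Ring (CliffordAlgebra (carForm J)))

instance (J : Conjugation K) : Algebra ℂ (CAR J) :=
  inferInstanceAs (Algebra ℂ (CliffordAlgebra (carForm J)))

/-- The Fermi field operators. -/
def field (J : Conjugation K) : K →ₗ[ℂ] CAR J := CliffordAlgebra.ι (carForm J)

theorem field_sq (J : Conjugation K) (f : K) :
    field J f * field J f = algebraMap ℂ (CAR J) (1 / 2 * ⟪J.toMap f, f⟫_ℂ) := by
  rw [← carForm_apply]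
  exact CliffordAlgebra.ι_sq_scalar (carForm J) f

/-- The canonical anticommutation relations. -/
theorem field_anticomm (J : Conjugation K) (f h : K) :
    field J f * field J h + field J h * field J f = algebraMap ℂ (CAR J) ⟪J.toMap f, h⟫_ℂ := by
  have h1 := field_sq J (f + h)
  have h2 : ⟪J.toMap h, f⟫_ℂ = ⟪J.toMap f, h⟫_ℂ := by
    have := J.inner_map_map f (J.toMap h)
    rw [J.involutive] at this
    exact this.symm
  have h3 : (1 / 2 * ⟪J.toMap (f + h), f + h⟫_ℂ : ℂ) = 1 / 2 * ⟪J.toMap f, f⟫_ℂ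
      + 1 / 2 * ⟪J.toMap h, h⟫_ℂ + ⟪J.toMap f, h⟫_ℂ := by
    rw [map_add, inner_add_left, inner_add_right, inner_add_right, h2]; ring
  rw [h3, (algebraMap ℂ (CAR J)).map_add, (algebraMap ℂ (CAR J)).map_add, ← field_sq, ← field_sq, map_add, add_mul, mul_add, mul_add] at h1
  rw [← add_right_inj (field J f * field J f + field J h * field J h), ← h1]
  abel

/-- The opposite of a complex algebra, with complex conjugate scalar multiplication. -/
def ConjOpposite (A : Type*) : Type _ := Aᵐᵒᵖ

instance (A : Type*) [Ring A] : Ring (ConjOpposite A) := inferInstanceAs (Ring Aᵐᵒᵖ)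


instance (A : Type*) [Ring A] [Algebra ℂ A] : Algebra ℂ (ConjOpposite A) :=
  RingHom.toAlgebra' ((algebraMap ℂ Aᵐᵒᵖ).comp (starRingEnd ℂ))
    (fun c x => Algebra.commutes (A := Aᵐᵒᵖ) (starRingEnd ℂ c) x)

/-- The adjoint as a linear multiplicative map into the conjugate opposite algebra: the extension
of `B f ↦ B (J f)`. -/
def adjointHom (J : Conjugation K) : CAR J →ₐ[ℂ] ConjOpposite (CAR J) :=
  CliffordAlgebra.lift (carForm J)
    ⟨{ toFun := fun f => MulOpposite.op (field J (J.toMap f))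
       map_add' := fun f g => by
         rw [map_add, map_add, MulOpposite.op_add]; rfl
       map_smul' := fun c f => by
         have h : field J (J.toMap (c • f))
             = field J (J.toMap f) * algebraMap ℂ (CAR J) (starRingEnd ℂ c) := by
           rw [map_smulₛₗ, map_smul, Algebra.smul_def, Algebra.commutes]
         exact congrArg MulOpposite.op h },
      fun f => by
        have h := field_sq J (J.toMap f)
        have h2 : (1 / 2 * ⟪J.toMap (J.toMap f), J.toMap f⟫_ℂ : ℂ)
            = starRingEnd ℂ (carForm J f) := by
          rw [J.involutive, carForm_apply, map_mul, inner_conj_symm, map_div₀, map_one,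
            Complex.conj_ofNat]
        rw [h2] at h
        exact congrArg MulOpposite.op h⟩

/-- The adjoint on the CAR algebra: the antilinear antimultiplicative map with
`(B f)⋆ = B (J f)`. -/
def adjoint (J : Conjugation K) (x : CAR J) : CAR J :=
  MulOpposite.unop (adjointHom J x : (CAR J)ᵐᵒᵖ)

theorem adjoint_field (J : Conjugation K) (f : K) :
    adjoint J (field J f) = field J (J.toMap f) :=
  congrArg MulOpposite.unop (CliffordAlgebra.lift_ι_apply (Q := carForm J)
    (A := ConjOpposite (CAR J)) _ _ f)

theorem adjoint_algebraMap (J : Conjugation K) (c : ℂ) :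
    adjoint J (algebraMap ℂ (CAR J) c) = algebraMap ℂ (CAR J) (starRingEnd ℂ c) :=
  congrArg MulOpposite.unop ((adjointHom J).commutes c)

theorem adjoint_mul (J : Conjugation K) (x y : CAR J) :
    adjoint J (x * y) = adjoint J y * adjoint J x :=
  congrArg MulOpposite.unop (map_mul (adjointHom J) x y)

theorem adjoint_add (J : Conjugation K) (x y : CAR J) :
    adjoint J (x + y) = adjoint J x + adjoint J y :=
  congrArg MulOpposite.unop (map_add (adjointHom J) x y)

theorem adjoint_adjoint (J : Conjugation K) (x : CAR J) : adjoint J (adjoint J x) = x := by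
  refine CliffordAlgebra.induction (Q := carForm J)
    (C := fun x : CAR J => adjoint J (adjoint J x) = x) ?_ ?_ ?_ ?_ x
  · intro c
    refine (congrArg (adjoint J) (adjoint_algebraMap J c)).trans ?_
    refine (adjoint_algebraMap J _).trans ?_
    rw [Complex.conj_conj]; rfl
  · intro f
    refine (congrArg (adjoint J) (adjoint_field J f)).trans ?_
    refine (adjoint_field J _).trans ?_
    rw [J.involutive]; rfl
  · intro a b ha hb
    refine (congrArg (adjoint J) (adjoint_mul J a b)).trans ?_
    refine (adjoint_mul J _ _).trans ?_
    rw [ha, hb]; rfl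
  · intro a b ha hb
    refine (congrArg (adjoint J) (adjoint_add J a b)).trans ?_
    refine (adjoint_add J _ _).trans ?_
    rw [ha, hb]; rfl

instance instStarRing (J : Conjugation K) : StarRing (CAR J) where
  star := adjoint J
  star_involutive := adjoint_adjoint J
  star_mul := adjoint_mul J
  star_add := adjoint_add J

theorem star_field (J : Conjugation K) (f : K) : star (field J f) = field J (J.toMap f) :=
  adjoint_field J f

instance (J : Conjugation K) : StarModule ℂ (CAR J) where
  star_smul c x := by
    rw [Algebra.smul_def, star_mul, Algebra.smul_def, Algebra.commutes]
    exact congrArg (star x * ·) (adjoint_algebraMap J c)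

/-- Covariance operators: `0 ≤ S ≤ 1` and `S + J S J = 1`. -/
structure IsCovarianceOperator (J : Conjugation K) (S : K →ₗ[ℂ] K) : Prop where
  isPositive : S.IsPositive
  one_sub_isPositive : (1 - S).IsPositive
  add_conj : ∀ f, S f + J.toMap (S (J.toMap f)) = f

/-- Basis projections: covariance operators that are projections. -/
structure IsBasisProjection (J : Conjugation K) (P : K →ₗ[ℂ] K) : Prop
    extends IsCovarianceOperator J P where
  idempotent : P * P = P

theorem IsCovarianceOperator.inner_self {J : Conjugation K} {S : K →ₗ[ℂ] K}
    (hS : IsCovarianceOperator J S) (f : K) :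
    ⟪J.toMap f, S f⟫_ℂ = 1 / 2 * ⟪J.toMap f, f⟫_ℂ := by
  have h1 : ⟪J.toMap f, J.toMap (S (J.toMap f))⟫_ℂ = ⟪J.toMap f, S f⟫_ℂ := by
    rw [J.inner_map_map, hS.isPositive.isSymmetric]
  have h2 : ⟪J.toMap f, f⟫_ℂ = ⟪J.toMap f, S f⟫_ℂ + ⟪J.toMap f, S f⟫_ℂ := by
    nth_rewrite 2 [← h1]
    rw [← inner_add_right, hS.add_conj]
  rw [h2]; ring

/-- The antiderivation of the CAR algebra with `B f ↦ d f`. -/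
def contract (J : Conjugation K) (d : Module.Dual ℂ K) : CAR J →ₗ[ℂ] CAR J :=
  CliffordAlgebra.contractLeft (Q := carForm J) d

theorem contract_one (J : Conjugation K) (d : Module.Dual ℂ K) : contract J d 1 = 0 :=
  CliffordAlgebra.contractLeft_one (Q := carForm J) (d := d)

theorem contract_field_mul (J : Conjugation K) (d : Module.Dual ℂ K) (f : K) (x : CAR J) :
    contract J d (field J f * x) = d f • x - field J f * contract J d x :=
  CliffordAlgebra.contractLeft_ι_mul (Q := carForm J) (d := d) f x

/-- The quasifree state with covariance operator `S`: the unital functional on the CAR algebra with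
two-point function `⟪J f, S h⟫` whose higher correlations are given by Wick's theorem
(`quasifreeState_field_mul_field` and `quasifreeState_prod` below). The CAR algebra is mapped to
the exterior algebra by Wick ordering with respect to this two-point function (Mathlib's
`changeForm` is the linear map that turns products of fields into their Wick-ordered expansion),
and the degree zero part is returned. -/
def quasifreeState (J : Conjugation K) {S : K →ₗ[ℂ] K} (hS : IsCovarianceOperator J S) :
    CAR J →ₗ[ℂ] ℂ :=
  (ExteriorAlgebra.algebraMapInv (R := ℂ) (M := K)).toLinearMap ∘ₗ
    CliffordAlgebra.changeForm (Q := carForm J) (Q' := 0) (B := -pairing J S) (by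
      ext f
      simp [carForm_apply, hS.inner_self])

theorem quasifreeState_one (J : Conjugation K) {S : K →ₗ[ℂ] K} (hS : IsCovarianceOperator J S) :
    quasifreeState J hS 1 = 1 := by
  have h := CliffordAlgebra.changeForm_one (Q := carForm J) (Q' := 0) (B := -pairing J S) (by
      ext f
      simp [carForm_apply, hS.inner_self])
  exact (congrArg (ExteriorAlgebra.algebraMapInv (R := ℂ) (M := K)) h).trans (map_one _)

theorem quasifreeState_field_mul (J : Conjugation K) {S : K →ₗ[ℂ] K}
    (hS : IsCovarianceOperator J S) (f : K) (x : CAR J) :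
    quasifreeState J hS (field J f * x)
      = quasifreeState J hS (contract J (pairing J S f) x) := by
  have h : (-pairing J S).toQuadraticMap = 0 - carForm J := by
    ext f
    simp [carForm_apply, hS.inner_self]
  have h1 := CliffordAlgebra.changeForm_ι_mul h f x
  have h2 := CliffordAlgebra.changeForm_contractLeft h (pairing J S f) x
  refine (congrArg (ExteriorAlgebra.algebraMapInv (R := ℂ) (M := K)) h1).trans ?_
  refine Eq.trans ?_ (congrArg (ExteriorAlgebra.algebraMapInv (R := ℂ) (M := K)) h2).symm
  have h3 : ExteriorAlgebra.algebraMapInv (R := ℂ) (M := K) (CliffordAlgebra.ι 0 f) = 0 :=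
    (ExteriorAlgebra.lift_ι_apply ℂ (0 : K →ₗ[ℂ] ℂ) (fun _ => by simp) f)
  rw [LinearMap.neg_apply, map_neg, LinearMap.neg_apply, sub_neg_eq_add, map_add]
  erw [map_mul, h3]
  rw [zero_mul, zero_add]

/-- The Wick expansion with two-point function `G`: the sum over all pairings of the list, with
signs, of the products of two-point functions, in recursive form (the first entry is paired with
each of the others in turn). It is zero on lists of odd length. -/
def wickSum (G : K → K → ℂ) : List K → ℂ
  | [] => 1
  | f :: l => ∑ j : Fin l.length, (-1) ^ (j : ℕ) * G f (l.get j) * wickSum G (l.eraseIdx j)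
  termination_by l => l.length
  decreasing_by
    have := j.isLt
    simp only [List.length_eraseIdx, List.length_cons]
    split <;> omega

theorem contract_prod (J : Conjugation K) (d : Module.Dual ℂ K) (l : List K) :
    contract J d (l.map (field J)).prod
      = ∑ j : Fin l.length,
          ((-1) ^ (j : ℕ) * d (l.get j)) • ((l.eraseIdx j).map (field J)).prod := by
  induction l with
  | nil => simp [contract_one]
  | cons a l ih =>
    rw [List.map_cons, List.prod_cons, contract_field_mul, ih, Finset.mul_sum]
    simp [Fin.sum_univ_succ, pow_succ, sub_eq_add_neg]

/-- Wick's theorem for `quasifreeState`. -/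
theorem quasifreeState_prod (J : Conjugation K) {S : K →ₗ[ℂ] K} (hS : IsCovarianceOperator J S)
    (l : List K) :
    quasifreeState J hS (l.map (field J)).prod = wickSum (fun f h => ⟪J.toMap f, S h⟫_ℂ) l := by
  induction hn : l.length using Nat.strong_induction_on generalizing l with
  | _ n ih =>
    cases l with
    | nil => rw [wickSum]; exact quasifreeState_one J hS
    | cons f l =>
      rw [List.map_cons, List.prod_cons, quasifreeState_field_mul, wickSum]
      rw [contract_prod, map_sum]
      refine Finset.sum_congr rfl fun j _ => ?_
      rw [map_smul, smul_eq_mul, ih (l.eraseIdx j).length _ _ rfl]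
      · rfl
      · have := j.isLt
        subst hn
        simp only [List.length_eraseIdx, List.length_cons]
        split <;> omega

/-- The two-point function of `quasifreeState`. -/
theorem quasifreeState_field_mul_field (J : Conjugation K) {S : K →ₗ[ℂ] K}
    (hS : IsCovarianceOperator J S) (f h : K) :
    quasifreeState J hS (field J f * field J h) = ⟪J.toMap f, S h⟫_ℂ := by
  have := quasifreeState_prod J hS [f, h]
  simpa [wickSum] using this

end CAR

section Fidelity

variable {A : Type*} [Ring A] [Algebra ℂ A] [StarRing A]

/-- States: positive unital functionals. -/
structure IsState (ω : A →ₗ[ℂ] ℂ) : Prop where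
  nonneg : ∀ a, 0 ≤ ω (star a * a)
  map_one : ω 1 = 1

/-- Faithful (positive) traces. -/
structure IsFaithfulTrace (τ : A →ₗ[ℂ] ℂ) : Prop where
  mul_comm : ∀ a b, τ (a * b) = τ (b * a)
  nonneg : ∀ a, 0 ≤ τ (star a * a)
  eq_zero : ∀ a, τ (star a * a) = 0 → a = 0

/-- `V` implements `ω`: `ω a = ⟨V, a V⟩` in the Hilbert-Schmidt inner product
`⟨V, W⟩ = τ (V⋆ W)` on `A`. -/
def Implements (τ : A →ₗ[ℂ] ℂ) (V : A) (ω : A →ₗ[ℂ] ℂ) : Prop :=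
  ∀ a, ω a = τ (star V * (a * V))

/-- The numbers `|⟨V, W⟩|` for `V` implementing `ω` and `W` implementing `φ`. -/
def overlaps (τ ω φ : A →ₗ[ℂ] ℂ) : Set ℝ :=
  {r | ∃ V W : A, Implements τ V ω ∧ Implements τ W φ ∧ r = ‖τ (star V * W)‖}

/-- The fidelity of two functionals, with respect to the faithful trace `τ`. -/
def fidelity (τ ω φ : A →ₗ[ℂ] ℂ) : ℝ := sSup (overlaps τ ω φ)

end Fidelity

end SelfDualCAR

end

open SelfDualCAR

noncomputable section

namespace SelfDualCAR

/-! A basis projection `P` has a minimal projection `p` in the algebra: for an orthonormal basis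
`e₁, …, eₙ` of the range of `P`, `p = B(Je₁)⋯B(Jeₙ)B(eₙ)⋯B(e₁)` satisfies `p x p = ω_P(x) p`
(`exists_support`). Every `V` implementing `ω_P` therefore has `pV = V`, so `⟨V, W⟩ = ⟨V, pW⟩`.
Cauchy–Schwarz bounds its modulus by `‖pW‖ = ω_S(p)^{1/2}`, and the normalized `pW` itself
implements `ω_P` and attains the bound (`isGreatest_overlaps`). Thus the squared fidelity is
`ω_S(p)`.

On the ordered factors of `p` the two-point function of `ω_S` agrees with the alternating form `⟪Jf,
(S - (1 - P))h⟫`, so `ω_S(p)` is a Pfaffian. Its square is a determinant (`wickSum_ofFn_sq`), and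
since the factors of `p` run over an orthonormal basis of `K`, the modulus of that determinant is
`|det(1 - P - S)|` (`norm_det_inner`).

Implementers exist (`exists_implements`) by induction on the rank of `S - S²`. If `S` is a
projection, a multiple of its `p` works. Otherwise take an isotropic eigenvector `e` with eigenvalue
`0 < s < 1`. Moving the eigenvalue to `0` or `1` gives covariance operators `S₀`, `S₁` with `ω_S =
(1 - s)ω_{S₀} + s ω_{S₁}` (`quasifreeState_affine`). Their selfadjoint implementers have product
zero, so a combination with square-root weights implements `ω_S`. Positivity of the states follows
from the existence of implementers. -/

theorem wickSum_congr {V : Type*} {G G' : V → V → ℂ} {l : List V}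
    (h : l.Pairwise fun f g => G f g = G' f g) : wickSum G l = wickSum G' l := by
  induction hn : l.length using Nat.strong_induction_on generalizing l with
  | _ n ih =>
    cases l with
    | nil => rw [wickSum, wickSum]
    | cons f l =>
      rw [wickSum, wickSum]
      rw [List.pairwise_cons] at h
      refine Finset.sum_congr rfl fun j _ => ?_
      rw [h.1 _ (List.get_mem l j),
        ih (l.eraseIdx j).length _ (h.2.sublist (List.eraseIdx_sublist l j)) rfl]
      have := j.isLt
      subst hn
      simp only [List.length_eraseIdx, List.length_cons]
      split <;> omega

/-! ### Pfaffians of alternating forms by contraction in the exterior algebra. -/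

section Pfaffian

variable {V : Type*} [AddCommGroup V] [Module ℂ V]

/-- The vacuum functional on the exterior algebra with alternating two-point function `A`. -/
def exteriorWick (A : LinearMap.BilinForm ℂ V) (hA : A.IsAlt) : ExteriorAlgebra ℂ V →ₗ[ℂ] ℂ :=
  (ExteriorAlgebra.algebraMapInv (R := ℂ) (M := V)).toLinearMap ∘ₗ
    CliffordAlgebra.changeForm (Q := (0 : QuadraticForm ℂ V)) (Q' := 0) (B := -A) (by
      ext f
      simp [hA f])

open CliffordAlgebra in
theorem exteriorWick_one (A : LinearMap.BilinForm ℂ V) (hA : A.IsAlt) :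
    exteriorWick A hA 1 = 1 := by
  have h := changeForm_one (Q := (0 : QuadraticForm ℂ V)) (Q' := 0) (B := -A) (by
      ext f
      simp [hA f])
  exact (congrArg (ExteriorAlgebra.algebraMapInv (R := ℂ) (M := V)) h).trans (map_one _)

/-- The change of form produces `ι f * y` plus a contraction; the first term has no degree zero
part, so only the contraction survives. -/
theorem exteriorWick_ι_mul (A : LinearMap.BilinForm ℂ V) (hA : A.IsAlt) (f : V)
    (x : ExteriorAlgebra ℂ V) :
    exteriorWick A hA (ExteriorAlgebra.ι ℂ f * x)
      = exteriorWick A hA (CliffordAlgebra.contractLeft (Q := 0) (A f) x) := by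
  have h : (-A).toQuadraticMap = (0 : QuadraticForm ℂ V) - 0 := by
    ext f
    simp [hA f]
  have h1 := CliffordAlgebra.changeForm_ι_mul h f x
  have h2 := CliffordAlgebra.changeForm_contractLeft h (A f) x
  refine (congrArg (ExteriorAlgebra.algebraMapInv (R := ℂ) (M := V)) h1).trans ?_
  refine Eq.trans ?_ (congrArg (ExteriorAlgebra.algebraMapInv (R := ℂ) (M := V)) h2).symm
  have h3 : ExteriorAlgebra.algebraMapInv (R := ℂ) (M := V) (CliffordAlgebra.ι 0 f) = 0 :=
    (ExteriorAlgebra.lift_ι_apply ℂ (0 : V →ₗ[ℂ] ℂ) (fun _ => by simp) f)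
  rw [LinearMap.neg_apply, map_neg, LinearMap.neg_apply, sub_neg_eq_add, map_add]
  erw [map_mul, h3]
  rw [zero_mul, zero_add]

theorem contractLeft_prod (d : Module.Dual ℂ V) (l : List V) :
    CliffordAlgebra.contractLeft (Q := 0) d (l.map (ExteriorAlgebra.ι ℂ)).prod
      = ∑ j : Fin l.length,
          ((-1) ^ (j : ℕ) * d (l.get j)) • ((l.eraseIdx j).map (ExteriorAlgebra.ι ℂ)).prod := by
  induction l with
  | nil => simp
  | cons a l ih =>
    rw [List.map_cons, List.prod_cons]
    erw [CliffordAlgebra.contractLeft_ι_mul, ih]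
    rw [Finset.mul_sum]
    simp [Fin.sum_univ_succ, pow_succ, sub_eq_add_neg]

theorem contractLeft_prod_eq_zero (d : Module.Dual ℂ V) (l : List V) (h : ∀ x ∈ l, d x = 0) :
    CliffordAlgebra.contractLeft (Q := 0) d (l.map (ExteriorAlgebra.ι ℂ)).prod = 0 := by
  rw [contractLeft_prod]
  refine Finset.sum_eq_zero fun j _ => ?_
  rw [h _ (List.get_mem l j), mul_zero, zero_smul]

theorem exteriorWick_prod (A : LinearMap.BilinForm ℂ V) (hA : A.IsAlt) (l : List V) :
    exteriorWick A hA (l.map (ExteriorAlgebra.ι ℂ)).prod = wickSum (fun f h => A f h) l := by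
  induction hn : l.length using Nat.strong_induction_on generalizing l with
  | _ n ih =>
    cases l with
    | nil => rw [wickSum]; exact exteriorWick_one A hA
    | cons f l =>
      rw [List.map_cons, List.prod_cons, exteriorWick_ι_mul, wickSum]
      rw [contractLeft_prod, map_sum]
      refine Finset.sum_congr rfl fun j _ => ?_
      rw [map_smul, smul_eq_mul, ih (l.eraseIdx j).length _ _ rfl]
      have := j.isLt
      subst hn
      simp only [List.length_eraseIdx, List.length_cons]
      split <;> omega

/-- In the exterior algebra, the factors of `f ∧ g ∧ x` may be changed by multiples of
`f` and `g`. -/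
theorem ι_mul_ι_mul_map (f g : V) (p : V →ₗ[ℂ] V) (hp : ∀ v, ∃ a b : ℂ, v = p v + a • f + b • g)
    (x : ExteriorAlgebra ℂ V) :
    ExteriorAlgebra.ι ℂ f * ExteriorAlgebra.ι ℂ g * x
      = ExteriorAlgebra.ι ℂ f * ExteriorAlgebra.ι ℂ g * ExteriorAlgebra.map p x := by
  have swap : ∀ u v : V, ExteriorAlgebra.ι ℂ u * ExteriorAlgebra.ι ℂ v
      = - (ExteriorAlgebra.ι ℂ v * ExteriorAlgebra.ι ℂ u) := fun u v =>
    eq_neg_of_add_eq_zero_left (ExteriorAlgebra.ι_add_mul_swap u v)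
  have comm : ∀ v : V, ∀ y, ExteriorAlgebra.ι ℂ f * ExteriorAlgebra.ι ℂ g
      * (ExteriorAlgebra.ι ℂ v * y)
      = ExteriorAlgebra.ι ℂ v * (ExteriorAlgebra.ι ℂ f * ExteriorAlgebra.ι ℂ g * y) := by
    intro v y
    rw [← mul_assoc, mul_assoc _ _ (ExteriorAlgebra.ι ℂ v), swap g v, mul_neg, ← mul_assoc,
      swap f v]
    simp only [neg_mul, neg_neg, mul_assoc]
  induction x using CliffordAlgebra.left_induction with
  | algebraMap r => exact congrArg _ ((ExteriorAlgebra.map p).commutes r).symm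
  | add x y hx hy => rw [mul_add, hx, hy, map_add, mul_add]
  | ι_mul x v hx =>
    change _ * (ExteriorAlgebra.ι ℂ v * x) = _ * ExteriorAlgebra.map p (ExteriorAlgebra.ι ℂ v * x)
    rw [comm, hx, map_mul, ExteriorAlgebra.map_apply_ι, ← comm, ← mul_assoc, ← mul_assoc]
    congr 1
    obtain ⟨a, b, hv⟩ := hp v
    have h1 : ExteriorAlgebra.ι ℂ f * ExteriorAlgebra.ι ℂ g * ExteriorAlgebra.ι ℂ f = 0 := by
      rw [mul_assoc, swap g f, mul_neg, ← mul_assoc, ExteriorAlgebra.ι_sq_zero, zero_mul, neg_zero]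
    have h2 : ExteriorAlgebra.ι ℂ f * ExteriorAlgebra.ι ℂ g * ExteriorAlgebra.ι ℂ g = 0 := by
      rw [mul_assoc, ExteriorAlgebra.ι_sq_zero, mul_zero]
    conv_lhs => rw [hv]
    rw [map_add, map_add, map_smul, map_smul, mul_add, mul_add, mul_smul_comm, mul_smul_comm,
      h1, h2, smul_zero, smul_zero, add_zero, add_zero]

/-- One elimination step with pivot `a = A (f 0) (f 1)`. Making the remaining vectors `A`-orthogonal
to `f 0` and `f 1` takes a factor `a` out of the Pfaffian; the Schur complement of the corresponding
2×2 block takes `a²` out of the determinant. -/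
theorem exteriorWick_sq_of_ne_zero (A : LinearMap.BilinForm ℂ V) (hA : A.IsAlt) {m : ℕ}
    (ih : ∀ f : Fin m → V, exteriorWick A hA (ExteriorAlgebra.ιMulti ℂ m f) ^ 2
      = (Matrix.of fun i j => A (f i) (f j)).det)
    (f : Fin (m + 2) → V) (h : A (f 0) (f 1) ≠ 0) :
    exteriorWick A hA (ExteriorAlgebra.ιMulti ℂ (m + 2) f) ^ 2
      = (Matrix.of fun i j => A (f i) (f j)).det := by
  set a := A (f 0) (f 1) with ha
  have h10 : A (f 1) (f 0) = -a := by rw [ha, hA.neg_eq]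
  set r : Fin m → V := fun i => f i.succ.succ with hr
  -- Projection along the span of `f 0`, `f 1` onto its `A`-orthogonal complement.
  let p : V →ₗ[ℂ] V := LinearMap.id - (a⁻¹ • A.flip (f 1)).smulRight (f 0)
    + (a⁻¹ • A.flip (f 0)).smulRight (f 1)
  have hp : ∀ v, p v = v - (a⁻¹ * A v (f 1)) • f 0 + (a⁻¹ * A v (f 0)) • f 1 := fun v => by
    simp [p]
  have hp0 : ∀ v, A (f 0) (p v) = 0 := fun v => by
    have := hA.neg_eq v (f 0)
    rw [hp]
    simp only [map_add, map_sub, map_smul, hA (f 0), smul_eq_mul, ← ha, ← this]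
    field_simp
    ring
  have hp1 : ∀ v, A (f 1) (p v) = 0 := fun v => by
    have := hA.neg_eq v (f 1)
    rw [hp]
    simp only [map_add, map_sub, map_smul, hA (f 1), smul_eq_mul, h10, ← this]
    field_simp
    ring
  have e1 : exteriorWick A hA (ExteriorAlgebra.ιMulti ℂ (m + 2) f)
      = a * exteriorWick A hA (ExteriorAlgebra.ιMulti ℂ m fun i => p (r i)) := by
    have : ExteriorAlgebra.ιMulti ℂ (m + 2) f = ExteriorAlgebra.ι ℂ (f 0)
        * ExteriorAlgebra.ι ℂ (f 1) * ExteriorAlgebra.ιMulti ℂ m r := by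
      rw [ExteriorAlgebra.ιMulti_apply, ExteriorAlgebra.ιMulti_apply, List.ofFn_succ,
        List.ofFn_succ, List.prod_cons, List.prod_cons, mul_assoc]
      rfl
    rw [this, ι_mul_ι_mul_map (f 0) (f 1) p
      fun v => ⟨a⁻¹ * A v (f 1), -(a⁻¹ * A v (f 0)), by rw [hp]; module⟩]
    have h2 : ExteriorAlgebra.map p (ExteriorAlgebra.ιMulti ℂ m r)
        = ((List.ofFn fun i => p (r i)).map (ExteriorAlgebra.ι ℂ)).prod := by
      rw [ExteriorAlgebra.map_apply_ιMulti, ExteriorAlgebra.ιMulti_apply, List.map_ofFn]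
      rfl
    have h3 : ExteriorAlgebra.ιMulti ℂ m (fun i => p (r i))
        = ((List.ofFn fun i => p (r i)).map (ExteriorAlgebra.ι ℂ)).prod := by
      rw [ExteriorAlgebra.ιMulti_apply, List.map_ofFn]
      rfl
    rw [h2, h3, mul_assoc, exteriorWick_ι_mul]
    erw [CliffordAlgebra.contractLeft_ι_mul]
    rw [contractLeft_prod_eq_zero]
    · erw [mul_zero]
      rw [sub_zero]
      erw [map_smul]
      rw [smul_eq_mul]
    · intro x hx
      obtain ⟨i, rfl⟩ := (List.mem_ofFn' _ _).1 hx
      exact hp0 _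
  rw [e1, mul_pow, ih]
  let e : Fin 2 ⊕ Fin m ≃ Fin (m + 2) := finSumFinEquiv.trans (finCongr (add_comm 2 m))
  have el0 : e (Sum.inl 0) = 0 := rfl
  have el1 : e (Sum.inl 1) = 1 := by
    ext; simp [e]
  have er : ∀ i, f (e (Sum.inr i)) = r i := fun i => by
    simp only [hr]
    congr 1
    ext; simp [e]
  rw [← Matrix.det_submatrix_equiv_self e]
  let M11 : Matrix (Fin 2) (Fin 2) ℂ := !![0, a; -a, 0]
  let N11 : Matrix (Fin 2) (Fin 2) ℂ := !![0, -a⁻¹; a⁻¹, 0]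
  let inv : Invertible M11 := ⟨N11, by
    ext i j; fin_cases i <;> fin_cases j <;> simp [M11, N11, h], by
    ext i j; fin_cases i <;> fin_cases j <;> simp [M11, N11, h]⟩
  have hblock : (Matrix.of fun i j => A (f i) (f j)).submatrix e e
      = Matrix.fromBlocks M11 (Matrix.of fun i j => A (f (e (Sum.inl i))) (r j))
        (Matrix.of fun i j => A (r i) (f (e (Sum.inl j)))) (Matrix.of fun i j => A (r i) (r j)) := by
    ext i j
    rcases i with i | i <;> rcases j with j | j
    · fin_cases i <;> fin_cases j <;> simp [M11, el0, el1, hA (f 0), hA (f 1), h10, ha]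
    · simp [er]
    · simp [er]
    · simp [er]
  rw [hblock, Matrix.det_fromBlocks₁₁]
  have hdet : M11.det = a ^ 2 := by
    simp [M11, Matrix.det_fin_two]; ring
  have hinv : ⅟M11 = N11 := rfl
  rw [hdet, hinv]
  congr 2
  ext i j
  -- `p u - u` lies in the span of `f 0` and `f 1`, to which `p v` is `A`-orthogonal; so projecting
  -- one argument already gives the Schur complement.
  have h5 : A (p (r i)) (p (r j)) = A (r i) (p (r j)) := by
    rw [hp (r i)]
    simp only [map_add, map_sub, map_smul, LinearMap.add_apply, LinearMap.sub_apply,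
      LinearMap.smul_apply, hp0, hp1]
    simp
  have n0 := hA.neg_eq (r j) (f 0)
  have n1 := hA.neg_eq (r j) (f 1)
  rw [Matrix.of_apply, h5, hp (r j)]
  simp only [map_add, map_sub, map_smul, smul_eq_mul, Matrix.sub_apply, Matrix.mul_apply,
    Matrix.of_apply, Fin.sum_univ_two, N11, el0, el1, ← n0, ← n1]
  simp
  ring

/-- The square of the Pfaffian is the determinant. -/
theorem exteriorWick_sq (A : LinearMap.BilinForm ℂ V) (hA : A.IsAlt) :
    ∀ (m : ℕ) (f : Fin m → V), exteriorWick A hA (ExteriorAlgebra.ιMulti ℂ m f) ^ 2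
      = (Matrix.of fun i j => A (f i) (f j)).det
  | 0, f => by
    rw [ExteriorAlgebra.ιMulti_apply, List.ofFn_zero, List.prod_nil, exteriorWick_one]
    simp
  | 1, f => by
    rw [ExteriorAlgebra.ιMulti_apply, List.ofFn_succ, List.ofFn_zero, List.prod_cons,
      List.prod_nil, exteriorWick_ι_mul]
    erw [CliffordAlgebra.contractLeft_one]
    simp [hA (f 0)]
  | m + 2, f => by
    by_cases h : ∀ j : Fin (m + 1), A (f 0) (f j.succ) = 0
    · rw [Matrix.det_eq_zero_of_row_eq_zero 0]
      · have : ExteriorAlgebra.ιMulti ℂ (m + 2) f = ExteriorAlgebra.ι ℂ (f 0)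
            * ((List.ofFn fun i => f (Fin.succ i)).map (ExteriorAlgebra.ι ℂ)).prod := by
          rw [ExteriorAlgebra.ιMulti_apply, List.ofFn_succ, List.prod_cons, List.map_ofFn]
          rfl
        rw [this, exteriorWick_ι_mul, contractLeft_prod_eq_zero]
        · simp
        · intro x hx
          obtain ⟨i, rfl⟩ := (List.mem_ofFn' _ _).1 hx
          exact h i
      · intro j
        refine Fin.cases ?_ (fun j => ?_) j
        · exact hA _
        · exact h j
    · push Not at h
      obtain ⟨j, hj⟩ := h
      have key := exteriorWick_sq_of_ne_zero A hA (exteriorWick_sq A hA m)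
        (f ∘ Equiv.swap 1 j.succ) (by
          have h0 : Equiv.swap 1 j.succ (0 : Fin (m + 2)) = 0 :=
            Equiv.swap_apply_of_ne_of_ne (by simp) (Fin.succ_ne_zero j).symm
          simpa [h0] using hj)
      have hdet := Matrix.det_submatrix_equiv_self (Equiv.swap 1 j.succ)
        (Matrix.of fun i j => A (f i) (f j))
      rw [AlternatingMap.map_perm] at key
      refine Eq.trans ?_ (key.trans hdet)
      rcases Int.units_eq_one_or (Equiv.Perm.sign (Equiv.swap 1 j.succ)) with hs | hs <;>
        rw [hs] <;> simp

theorem wickSum_ofFn_sq (A : LinearMap.BilinForm ℂ V) (hA : A.IsAlt) {m : ℕ} (f : Fin m → V) :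
    wickSum (fun f h => A f h) (List.ofFn f) ^ 2
      = (Matrix.of fun i j => A (f i) (f j)).det := by
  rw [← exteriorWick_sq A hA, ← exteriorWick_prod A hA, ExteriorAlgebra.ιMulti_apply,
    List.map_ofFn]
  rfl

end Pfaffian

/-! ### Wick recursion and vacuum products in the CAR algebra. -/

section Algebra

variable {K : Type*} [NormedAddCommGroup K] [InnerProductSpace ℂ K]

theorem Conjugation.inner_map_left (J : Conjugation K) (f g : K) :
    ⟪J.toMap f, g⟫_ℂ = ⟪J.toMap g, f⟫_ℂ := by
  have := J.inner_map_map f (J.toMap g)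
  rwa [J.involutive] at this

theorem contract_add (J : Conjugation K) (d d' : Module.Dual ℂ K) (x : CAR J) :
    contract J (d + d') x = contract J d x + contract J d' x := by
  unfold contract
  rw [map_add]
  rfl

theorem contract_smul (J : Conjugation K) (c : ℂ) (d : Module.Dual ℂ K) (x : CAR J) :
    contract J (c • d) x = c • contract J d x := by
  unfold contract
  rw [map_smul]
  rfl

theorem contract_contract (J : Conjugation K) (d : Module.Dual ℂ K) (x : CAR J) :
    contract J d (contract J d x) = 0 :=
  CliffordAlgebra.contractLeft_contractLeft (Q := carForm J) (d := d) x

theorem contract_comm (J : Conjugation K) (d d' : Module.Dual ℂ K) (x : CAR J) :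
    contract J d (contract J d' x) = - contract J d' (contract J d x) :=
  CliffordAlgebra.contractLeft_comm (Q := carForm J) (d := d) (d' := d') x

theorem CAR.left_induction (J : Conjugation K) {C : CAR J → Prop}
    (algebraMap : ∀ c : ℂ, C (algebraMap ℂ (CAR J) c)) (add : ∀ x y, C x → C y → C (x + y))
    (field_mul : ∀ f x, C x → C (field J f * x)) (x : CAR J) : C x :=
  CliffordAlgebra.left_induction (Q := carForm J) (P := C) algebraMap add
    (fun x f hx => field_mul f x hx) x

/-- Products of fields span the CAR algebra. -/
theorem CAR.span_prod (J : Conjugation K) :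
    Submodule.span ℂ (Set.range fun l : List K => (l.map (field J)).prod) = ⊤ := by
  rw [eq_top_iff]
  intro x _
  induction x using CAR.left_induction with
  | algebraMap c =>
    rw [Algebra.algebraMap_eq_smul_one]
    exact Submodule.smul_mem _ _ (Submodule.subset_span ⟨[], by simp⟩)
  | add x y hx hy => exact Submodule.add_mem _ (hx trivial) (hy trivial)
  | field_mul f x hx =>
    refine Submodule.span_induction (p := fun x _ => field J f * x ∈ _) ?_ ?_ ?_ ?_ (hx trivial)
    · rintro _ ⟨l, rfl⟩
      exact Submodule.subset_span ⟨f :: l, by simp⟩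
    · simp
    · intro x y _ _ h1 h2
      rw [mul_add]
      exact Submodule.add_mem _ h1 h2
    · intro c x _ h
      rw [mul_smul_comm]
      exact Submodule.smul_mem _ _ h

/-- A linear map on the CAR algebra obeying the Wick recursion of a quasifree state is a multiple of
that state. -/
theorem eq_quasifreeState_smul (J : Conjugation K) {S : K →ₗ[ℂ] K}
    (hS : IsCovarianceOperator J S) {M : Type*} [AddCommGroup M] [Module ℂ M]
    (L : CAR J →ₗ[ℂ] M)
    (hL : ∀ f x, L (field J f * x) = L (contract J (pairing J S f) x)) (x : CAR J) :
    L x = quasifreeState J hS x • L 1 := by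
  suffices h : L = (quasifreeState J hS).smulRight (L 1) by
    conv_lhs => rw [h]
    rfl
  refine LinearMap.ext_on_range (CAR.span_prod J) fun l => ?_
  induction hn : l.length using Nat.strong_induction_on generalizing l with
  | _ n ih =>
    cases l with
    | nil => simp [quasifreeState_one]
    | cons f l =>
      rw [List.map_cons, List.prod_cons, hL, LinearMap.smulRight_apply, quasifreeState_field_mul,
        ← LinearMap.smulRight_apply, contract_prod, map_sum, map_sum]
      refine Finset.sum_congr rfl fun j _ => ?_
      rw [map_smul, map_smul, ih (l.eraseIdx j).length _ _ rfl]
      have := j.isLt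
      subst hn
      simp only [List.length_eraseIdx, List.length_cons]
      split <;> omega

/-- Quasifree states are affine along rank two perturbations of the two-point function. -/
theorem quasifreeState_affine (J : Conjugation K) {S S₀ S₁ : K →ₗ[ℂ] K}
    (hS : IsCovarianceOperator J S) (hS₀ : IsCovarianceOperator J S₀)
    (hS₁ : IsCovarianceOperator J S₁) (t : ℂ) (u v : Module.Dual ℂ K)
    (h : ∀ f, pairing J S f = pairing J S₀ f + t • (u f • v - v f • u))
    (h₁ : ∀ f, pairing J S₁ f = pairing J S₀ f + (u f • v - v f • u)) (x : CAR J) :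
    quasifreeState J hS x
      = (1 - t) * quasifreeState J hS₀ x + t * quasifreeState J hS₁ x := by
  -- The rank two change acts through the double contraction by `v` and `u`. This operation squares
  -- to zero, so its exponential stops at first order in `s`; the candidate is recognized by its
  -- Wick recursion.
  have key : ∀ (T : K →ₗ[ℂ] K) (hT : IsCovarianceOperator J T) (s : ℂ)
      (_ : ∀ f, pairing J T f = pairing J S₀ f + s • (u f • v - v f • u)) (x : CAR J),
      quasifreeState J hT x = quasifreeState J hS₀ x
        - s * quasifreeState J hS₀ (contract J u (contract J v x)) := by
    intro T hT s hs x
    have := eq_quasifreeState_smul J hT (quasifreeState J hS₀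
      - s • (quasifreeState J hS₀ ∘ₗ contract J u ∘ₗ contract J v)) (fun f x => ?_) x
    · simpa [contract_one, quasifreeState_one] using this.symm
    · have e1 : contract J u (contract J v (field J f * x))
          = v f • contract J u x - u f • contract J v x
            + field J f * contract J u (contract J v x) := by
        rw [contract_field_mul, map_sub, map_smul, contract_field_mul]
        abel
      have e2 : contract J (pairing J T f) x = contract J (pairing J S₀ f) x
          + s • (u f • contract J v x - v f • contract J u x) := by
        rw [hs, sub_eq_add_neg, ← neg_smul, contract_add, contract_smul, contract_add,
          contract_smul, contract_smul, neg_smul, ← sub_eq_add_neg]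
      have e3 : contract J u (contract J v (contract J v x)) = 0 := by
        rw [contract_contract, map_zero]
      have e4 : contract J u (contract J v (contract J u x)) = 0 := by
        rw [contract_comm, contract_contract, map_zero, neg_zero]
      have e5 : contract J u (contract J v (contract J (pairing J S₀ f) x))
          = contract J (pairing J S₀ f) (contract J u (contract J v x)) := by
        rw [contract_comm J v, map_neg, contract_comm J u, neg_neg]
      simp only [LinearMap.sub_apply, LinearMap.smul_apply, LinearMap.comp_apply, smul_eq_mul]
      rw [e1, e2]
      simp only [map_add, map_smul, map_sub, map_zero, e3, e4, e5, quasifreeState_field_mul, smul_eq_mul]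
      ring
  rw [key S hS t h, key S₁ hS₁ 1 (by simpa using h₁)]
  ring

/-- Each field crossed by `B f` contributes its anticommutator, and these add up to the contraction.
The `y` built here is `x` with its odd part negated; only its existence matters, because the last
term will be annihilated by a vacuum projection. -/
theorem exists_field_mul_eq (J : Conjugation K) (f : K) (x : CAR J) :
    ∃ y, field J f * x = contract J (pairing J LinearMap.id f) x + y * field J f := by
  induction x using CAR.left_induction with
  | algebraMap c =>
    refine ⟨algebraMap ℂ (CAR J) c, ?_⟩
    rw [Algebra.commutes, Algebra.algebraMap_eq_smul_one, map_smul, contract_one, smul_zero,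
      zero_add]
  | add x y hx hy =>
    obtain ⟨x', hx⟩ := hx
    obtain ⟨y', hy⟩ := hy
    exact ⟨x' + y', by rw [mul_add, hx, hy, map_add, add_mul]; abel⟩
  | field_mul g x hx =>
    obtain ⟨y, hy⟩ := hx
    refine ⟨-(field J g * y), ?_⟩
    rw [← mul_assoc, eq_sub_of_add_eq (field_anticomm J f g), sub_mul, mul_assoc, hy,
      contract_field_mul, mul_add, neg_mul, mul_assoc, Algebra.algebraMap_eq_smul_one,
      smul_mul_assoc, one_mul]
    simp only [pairing_apply, LinearMap.id_apply]
    abel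

/-- The ordered product `B (J e₁) ⋯ B (J eₙ) B eₙ ⋯ B e₁`. -/
def vacuum (J : Conjugation K) : List K → CAR J
  | [] => 1
  | e :: l => field J (J.toMap e) * vacuum J l * field J e

theorem star_vacuum (J : Conjugation K) (l : List K) : star (vacuum J l) = vacuum J l := by
  induction l with
  | nil => exact star_one _
  | cons e l ih =>
    rw [vacuum, star_mul, star_mul, star_field, star_field, ih, J.involutive, mul_assoc]

theorem vacuum_eq_prod (J : Conjugation K) (l : List K) :
    vacuum J l = ((l.map J.toMap ++ l.reverse).map (field J)).prod := by
  induction l with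
  | nil => simp [vacuum]
  | cons e l ih =>
    rw [vacuum, ih]
    simp [mul_assoc]

theorem field_anticomm_of_inner_eq_zero (J : Conjugation K) {f g : K}
    (h : ⟪J.toMap f, g⟫_ℂ = 0) : field J f * field J g = - (field J g * field J f) := by
  have := field_anticomm J f g
  rw [h, map_zero] at this
  exact eq_neg_of_add_eq_zero_left this

/-- `B g` anticommutes with each of an even number of factors. -/
theorem field_mul_vacuum_comm (J : Conjugation K) (g : K) (l : List K)
    (h : ∀ e ∈ l, ⟪J.toMap g, e⟫_ℂ = 0 ∧ ⟪g, e⟫_ℂ = 0) :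
    field J g * vacuum J l = vacuum J l * field J g := by
  induction l with
  | nil => simp [vacuum]
  | cons e l ih =>
    have h1 := field_anticomm_of_inner_eq_zero J (h e (by simp)).1
    have h2 : field J g * field J (J.toMap e) = - (field J (J.toMap e) * field J g) := by
      apply field_anticomm_of_inner_eq_zero
      rw [J.inner_map_map, ← inner_conj_symm, (h e (by simp)).2, map_zero]
    rw [vacuum, ← mul_assoc, ← mul_assoc, h2, neg_mul, mul_assoc _ (field J g),
      ih fun e he => h e (by simp [he]), ← mul_assoc, neg_mul, mul_assoc _ (field J g), h1,
      mul_neg, neg_neg, mul_assoc _ _ (field J g)]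

/-- `B (J e)` anticommutes through the earlier conjugate fields until it meets its own copy, where
it squares to zero. -/
theorem field_mul_vacuum_eq_zero (J : Conjugation K) (l : List K)
    (h : ∀ e ∈ l, ∀ e' ∈ l, ⟪e, J.toMap e'⟫_ℂ = 0) :
    ∀ e ∈ l, field J (J.toMap e) * vacuum J l = 0 := by
  induction l with
  | nil => simp
  | cons e l ih =>
    intro e' he'
    have h2 : field J (J.toMap e') * field J (J.toMap e)
        = - (field J (J.toMap e) * field J (J.toMap e')) := by
      apply field_anticomm_of_inner_eq_zero
      rw [J.involutive]
      exact h _ he' _ (by simp)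
    rcases List.mem_cons.1 he' with rfl | he'
    · rw [vacuum, mul_assoc, ← mul_assoc, field_sq, J.involutive, h _ (by simp) _ (by simp)]
      simp
    · rw [vacuum, ← mul_assoc, ← mul_assoc, h2, neg_mul, mul_assoc _ (field J (J.toMap e')),
        ih (fun a ha b hb => h a (by simp [ha]) b (by simp [hb])) e' he']
      simp

/-- On an element killed by `B (J e)`, the pair `B (J e) B e = 1 - B e B (J e)` acts as the
identity. With `p` the vacuum product itself this gives idempotence. -/
theorem vacuum_mul_eq_self (J : Conjugation K) (p : CAR J) (l : List K)
    (hl : l.Pairwise fun e e' => ⟪e, e'⟫_ℂ = 0) (hn : ∀ e ∈ l, ⟪e, e⟫_ℂ = 1)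
    (h : ∀ e ∈ l, ∀ e' ∈ l, ⟪J.toMap e, e'⟫_ℂ = 0)
    (hp : ∀ e ∈ l, field J (J.toMap e) * p = 0) : vacuum J l * p = p := by
  induction l with
  | nil => simp [vacuum]
  | cons e l ih =>
    rw [List.pairwise_cons] at hl
    have h1 := field_anticomm J (J.toMap e) e
    rw [J.involutive, hn e (by simp), map_one] at h1
    rw [vacuum, mul_assoc _ _ (field J e), ← field_mul_vacuum_comm J e l
      fun e' he' => ⟨h _ (by simp) _ (by simp [he']), hl.1 _ he'⟩, ← mul_assoc, mul_assoc,
      ih hl.2 (fun e he => hn e (by simp [he]))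
        (fun a ha b hb => h a (by simp [ha]) b (by simp [hb])) (fun e he => hp e (by simp [he])),
      eq_sub_of_add_eq h1, sub_mul, mul_assoc, hp e (by simp)]
    simp

end Algebra

/-! ### Basis projections, their minimal projections and the determinant formula. -/

section BasisProjection

variable {K : Type*} [NormedAddCommGroup K] [InnerProductSpace ℂ K] [FiniteDimensional ℂ K]

theorem Conjugation.exists_orthonormalBasis (J : Conjugation K) {ι : Type*} [Fintype ι]
    (b : OrthonormalBasis ι ℂ K) : ∃ b' : OrthonormalBasis ι ℂ K, ∀ i, b' i = J.toMap (b i) := by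
  classical
  have hv : Orthonormal ℂ (Set.univ.domRestrict fun i => J.toMap (b i)) := by
    rw [orthonormal_iff_ite]
    rintro ⟨i, _⟩ ⟨j, _⟩
    simp only [Set.domRestrict_apply, J.inner_map_map, orthonormal_iff_ite.1 b.orthonormal,
      Subtype.mk.injEq, eq_comm]
  obtain ⟨b', hb'⟩ := hv.exists_orthonormalBasis_extension_of_card_eq
    (Module.finrank_eq_card_basis b.toBasis)
  exact ⟨b', fun i => hb' i trivial⟩

/-- The matrix is that of `T` in `b` times the change of basis between `b` and its conjugate. Both
bases are orthonormal, so the extra determinant has modulus one. -/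
theorem norm_det_inner (J : Conjugation K) (T : K →ₗ[ℂ] K) {ι : Type*} [Fintype ι] [DecidableEq ι]
    (b : OrthonormalBasis ι ℂ K) :
    ‖(Matrix.of fun i j => ⟪J.toMap (b i), T (b j)⟫_ℂ).det‖ = ‖LinearMap.det T‖ := by
  obtain ⟨b', hb'⟩ := J.exists_orthonormalBasis b
  have h : (Matrix.of fun i j => ⟪J.toMap (b i), T (b j)⟫_ℂ)
      = b'.toBasis.toMatrix b * LinearMap.toMatrix b.toBasis b.toBasis T := by
    ext i j
    rw [Matrix.mul_apply, Matrix.of_apply, ← hb', ← b.sum_inner_mul_inner]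
    refine Finset.sum_congr rfl fun k _ => ?_
    simp [Module.Basis.toMatrix_apply, LinearMap.toMatrix_apply, OrthonormalBasis.repr_apply_apply]
  rw [h, Matrix.det_mul, LinearMap.det_toMatrix, norm_mul, ← Module.Basis.det_apply,
    OrthonormalBasis.det_to_matrix_orthonormalBasis, one_mul]

namespace IsBasisProjection

variable {J : Conjugation K} {P : K →ₗ[ℂ] K}

omit [FiniteDimensional ℂ K] in
theorem apply_conj (hP : IsBasisProjection J P) {f : K} (hf : P f = f) : P (J.toMap f) = 0 := by
  have := hP.add_conj (J.toMap f)
  rwa [J.involutive, hf, add_eq_right] at this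

omit [FiniteDimensional ℂ K] in
theorem apply_apply (hP : IsBasisProjection J P) (f : K) : P (P f) = P f :=
  LinearMap.congr_fun hP.idempotent f

omit [FiniteDimensional ℂ K] in
theorem inner_conj_eq_zero (hP : IsBasisProjection J P) {f g : K} (hf : P f = f) (hg : P g = g) :
    ⟪J.toMap f, g⟫_ℂ = 0 := by
  rw [← hg, ← hP.isPositive.isSymmetric, hP.apply_conj hf, inner_zero_left]

/-- An orthonormal basis of the range of a basis projection. -/
theorem exists_orthonormal (hP : IsBasisProjection J P) :
    ∃ (n : ℕ) (e : Fin n → K), Orthonormal ℂ e ∧ (∀ i, P (e i) = e i) ∧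
      ∀ f, P f = f → f = ∑ i, ⟪e i, f⟫_ℂ • e i := by
  let b := stdOrthonormalBasis ℂ (LinearMap.range P)
  refine ⟨_, fun i => (b i : K), ?_, fun i => ?_, fun f hf => ?_⟩
  · exact b.orthonormal.comp_linearIsometry (LinearMap.range P).subtypeₗᵢ
  · obtain ⟨y, hy⟩ := (b i).2
    change P (b i) = b i
    rw [← hy, hP.apply_apply]
  · have := congrArg Subtype.val (b.sum_repr' ⟨f, f, hf⟩)
    simpa using this.symm

/-- The range of a basis projection and its conjugate make up an orthonormal basis. -/
theorem exists_orthonormalBasis (hP : IsBasisProjection J P) :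
    ∃ (n : ℕ) (e : Fin n → K) (b : OrthonormalBasis (Fin (n + n)) ℂ K),
      (∀ i, P (e i) = e i) ∧ (∀ f, P f = f → f = ∑ i, ⟪e i, f⟫_ℂ • e i) ∧
      ⇑b = Fin.append (fun i => J.toMap (e i)) fun i => e i.rev := by
  obtain ⟨n, e, he, hPe, hsum⟩ := hP.exists_orthonormal
  -- Conjugates first, then the `e i` in reverse: the order of the factors in `vacuum`.
  set v : Fin (n + n) → K := Fin.append (fun i => J.toMap (e i)) fun i => e i.rev with hv
  have hv1 : ∀ i, v (Fin.castAdd n i) = J.toMap (e i) := Fin.append_left _ _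
  have hv2 : ∀ i, v (Fin.natAdd n i) = e i.rev := Fin.append_right _ _
  have hon : Orthonormal ℂ v := by
    rw [orthonormal_iff_ite] at he ⊢
    intro i j
    refine Fin.addCases (fun i => ?_) (fun i => ?_) i <;>
      refine Fin.addCases (fun j => ?_) (fun j => ?_) j
    · rw [hv1, hv1, J.inner_map_map, he]
      simp [eq_comm]
    · rw [hv1, hv2, hP.inner_conj_eq_zero (hPe _) (hPe _), if_neg]
      intro h
      have := congrArg Fin.val h
      simp at this
      omega
    · rw [hv1, hv2, ← inner_conj_symm, hP.inner_conj_eq_zero (hPe _) (hPe _), if_neg, map_zero]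
      intro h
      have := congrArg Fin.val h
      simp at this
      omega
    · rw [hv2, hv2, he]
      simp
  have hspan : ⊤ ≤ Submodule.span ℂ (Set.range v) := by
    intro x _
    have h2 : ∀ i, e i ∈ Submodule.span ℂ (Set.range v) := fun i => by
      rw [← Fin.rev_rev i, ← hv2]
      exact Submodule.subset_span ⟨_, rfl⟩
    rw [← hP.add_conj x]
    refine Submodule.add_mem _ ?_ ?_
    · rw [hsum _ (hP.apply_apply x)]
      exact Submodule.sum_mem _ fun i _ => Submodule.smul_mem _ _ (h2 i)
    · rw [hsum _ (hP.apply_apply (J.toMap x)), map_sum]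
      refine Submodule.sum_mem _ fun i _ => ?_
      rw [map_smulₛₗ, ← hv1]
      exact Submodule.smul_mem _ _ (Submodule.subset_span ⟨_, rfl⟩)
  exact ⟨n, e, OrthonormalBasis.mk hon hspan, hPe, hsum, OrthonormalBasis.coe_mk _ _⟩

omit [FiniteDimensional ℂ K] in
-- On the diagonal, `S` and `P` each contribute half of `⟪J f, f⟫`, which cancels the contribution
-- of `1`.
theorem isAlt_pairing (hP : IsBasisProjection J P) {S : K →ₗ[ℂ] K}
    (hS : IsCovarianceOperator J S) : (pairing J (S - (1 - P))).IsAlt := by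
  intro f
  rw [pairing_apply, LinearMap.sub_apply, LinearMap.sub_apply, inner_sub_right, inner_sub_right,
    hS.inner_self, hP.toIsCovarianceOperator.inner_self, Module.End.one_apply]
  ring

/-- The support projection of the quasifree state of a basis projection. -/
theorem exists_support (hP : IsBasisProjection J P) :
    ∃ p : CAR J, star p = p ∧ p * p = p ∧
      (∀ x, p * x * p = quasifreeState J hP.toIsCovarianceOperator x • p) ∧
      ∀ (S : K →ₗ[ℂ] K) (hS : IsCovarianceOperator J S),
        ‖quasifreeState J hS p‖ ^ 2 = ‖LinearMap.det (1 - P - S)‖ := by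
  obtain ⟨n, e, b, hPe, hsum, hb⟩ := hP.exists_orthonormalBasis
  have hb1 : ∀ i, b (Fin.castAdd n i) = J.toMap (e i) := fun i => by
    rw [hb, Fin.append_left]
  have hb2 : ∀ i, b (Fin.natAdd n i) = e i.rev := fun i => by
    rw [hb, Fin.append_right]
  have hinj : ∀ i j, ⟪e i, e j⟫_ℂ = if i = j then 1 else 0 := fun i j => by
    have := orthonormal_iff_ite.1 b.orthonormal (Fin.natAdd n i.rev) (Fin.natAdd n j.rev)
    rw [hb2, hb2] at this
    simpa using this
  have hJ : ∀ i j, ⟪J.toMap (e i), e j⟫_ℂ = 0 := fun i j =>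
    hP.inner_conj_eq_zero (hPe i) (hPe j)
  have hJ' : ∀ i j, ⟪e i, J.toMap (e j)⟫_ℂ = 0 := fun i j => by
    rw [← inner_conj_symm, hJ, map_zero]
  set l := List.ofFn e with hl
  set p := vacuum J l with hp
  have mem : ∀ x, x ∈ l ↔ ∃ i, e i = x := fun x => by simp [l]
  have hstar : star p = p := star_vacuum J l
  have hzero : ∀ i, field J (J.toMap (e i)) * p = 0 := fun i => by
    refine field_mul_vacuum_eq_zero J l ?_ _ ((mem _).2 ⟨i, rfl⟩)
    simp only [mem]
    rintro _ ⟨i, rfl⟩ _ ⟨j, rfl⟩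
    exact hJ' i j
  have hsq : p * p = p := by
    refine vacuum_mul_eq_self J p l ?_ ?_ ?_ ?_
    · rw [hl, List.pairwise_ofFn]
      intro i j hij
      rw [hinj, if_neg hij.ne]
    · simp only [mem]
      rintro _ ⟨i, rfl⟩
      rw [hinj, if_pos rfl]
    · simp only [mem]
      rintro _ ⟨i, rfl⟩ _ ⟨j, rfl⟩
      exact hJ i j
    · simp only [mem]
      rintro _ ⟨i, rfl⟩
      exact hzero i
  have hzero' : ∀ f, P f = f → field J (J.toMap f) * p = 0 := fun f hf => by
    rw [hsum f hf, map_sum, map_sum, Finset.sum_mul]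
    refine Finset.sum_eq_zero fun i _ => ?_
    rw [map_smulₛₗ, map_smul, smul_mul_assoc, hzero, smul_zero]
  have hzero'' : ∀ f, P f = f → p * field J f = 0 := fun f hf => by
    have := congrArg star (hzero' f hf)
    rwa [star_mul, star_field, J.involutive, star_zero, hstar] at this
  refine ⟨p, hstar, hsq, fun x => ?_, fun S hS => ?_⟩
  -- The compression `x ↦ p x p` obeys the Wick recursion of `P`: splitting `f = P f + J P J f`, the
  -- first part is killed by the left `p`, and the second is moved to the right `p`, leaving only
  -- its contraction.
  · have := eq_quasifreeState_smul J hP.toIsCovarianceOperator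
      (LinearMap.mulRight ℂ p ∘ₗ LinearMap.mulLeft ℂ p) (fun f x => ?_) x
    · simpa [hsq] using this
    · simp only [LinearMap.comp_apply, LinearMap.mulLeft_apply, LinearMap.mulRight_apply]
      set g := J.toMap (P (J.toMap f)) with hg
      have hfg : f = P f + g := (hP.add_conj f).symm
      have h1 : field J f * x = field J (P f) * x + field J g * x := by
        conv_lhs => rw [hfg, map_add, add_mul]
      obtain ⟨y, hy⟩ := exists_field_mul_eq J g x
      have h2 : pairing J LinearMap.id g = pairing J P f := by
        ext h
        rw [pairing_apply, pairing_apply, hg, J.involutive, hP.isPositive.isSymmetric]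
        rfl
      rw [h1, mul_add, ← mul_assoc p (field J (P f)), hzero'' _ (hP.apply_apply f), zero_mul,
        zero_add, hy, h2, mul_add, add_mul, mul_assoc p (y * _), mul_assoc y,
        hzero' _ (hP.apply_apply _), mul_zero, mul_zero, add_zero]
  · have hlist : l.map J.toMap ++ l.reverse = List.ofFn b := by
      rw [hb, List.ofFn_fin_append, hl, List.map_ofFn]
      congr 1
      refine List.ext_getElem (by simp) fun i h1 h2 => ?_
      simp only [List.getElem_reverse, List.getElem_ofFn, List.length_ofFn]
      congr 1
      ext
      simp
      omega
    -- The Wick sum sees only pairs in list order. There `⟪J f, (1 - P) h⟫` vanishes: `1 - P` kills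
    -- a later `e j`, and two conjugates give `⟪e i, J (e j)⟫ = 0`; an `e` never precedes a
    -- conjugate.
    have hwick : quasifreeState J hS p
        = wickSum (fun f h => pairing J (S - (1 - P)) f h) (List.ofFn b) := by
      rw [hp, vacuum_eq_prod, hlist, quasifreeState_prod]
      refine wickSum_congr ?_
      rw [List.pairwise_ofFn]
      intro i j hij
      rw [pairing_apply, LinearMap.sub_apply, inner_sub_right, eq_comm, sub_eq_self,
        LinearMap.sub_apply, Module.End.one_apply]
      revert hij
      refine Fin.addCases (fun i => ?_) (fun i => ?_) i <;>
        refine Fin.addCases (fun j => ?_) (fun j => ?_) j <;> intro hij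
      · rw [hb1, hb1, J.involutive, hP.apply_conj (hPe _), sub_zero, hJ']
      · rw [hb2, hPe, sub_self, inner_zero_right]
      · exfalso
        rw [Fin.lt_def] at hij
        simp at hij
        omega
      · rw [hb2 j, hPe, sub_self, inner_zero_right]
    rw [← norm_pow, hwick, wickSum_ofFn_sq _ (hP.isAlt_pairing hS)]
    simp only [pairing_apply]
    rw [norm_det_inner, show S - (1 - P) = (-1 : ℂ) • (1 - P - S) by module, LinearMap.det_smul]
    simp

end IsBasisProjection

end BasisProjection

/-! ### Spectral analysis and rank two shifts of covariance operators. -/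

section Covariance

variable {K : Type*} [NormedAddCommGroup K] [InnerProductSpace ℂ K]

/-- `1 - S = J S J` inherits positivity from `S`. -/
theorem IsCovarianceOperator.of_isPositive {J : Conjugation K} {S : K →ₗ[ℂ] K}
    (hS : S.IsPositive) (h : ∀ f, S f + J.toMap (S (J.toMap f)) = f) :
    IsCovarianceOperator J S := by
  refine ⟨hS, ⟨fun x y => ?_, fun x => ?_⟩, h⟩
  · simp only [LinearMap.sub_apply, Module.End.one_apply, inner_sub_left, inner_sub_right,
      hS.isSymmetric x y]
  · have h1 : (1 - S) x = J.toMap (S (J.toMap x)) := by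
      rw [LinearMap.sub_apply, Module.End.one_apply, sub_eq_iff_eq_add']
      exact (h x).symm
    rw [h1, J.inner_map_left]
    exact hS.re_inner_nonneg_right _

namespace IsCovarianceOperator

variable {J : Conjugation K} {S : K →ₗ[ℂ] K}

theorem apply_conj (hS : IsCovarianceOperator J S) {e : K} {s : ℝ} (he : S e = (s : ℂ) • e) :
    S (J.toMap e) = ((1 - s : ℝ) : ℂ) • J.toMap e := by
  have := hS.add_conj (J.toMap e)
  rw [J.involutive, he, map_smulₛₗ, Complex.conj_ofReal] at this
  rw [eq_sub_of_add_eq this]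
  push_cast
  module

/-- `J e` is an eigenvector for `1 - s ≠ s`, and eigenvectors of a symmetric operator for distinct
eigenvalues are orthogonal. -/
theorem inner_conj_eq_zero (hS : IsCovarianceOperator J S) {e : K} {s : ℝ}
    (he : S e = (s : ℂ) • e) (hs : s ≠ 1 / 2) : ⟪J.toMap e, e⟫_ℂ = 0 := by
  have h := hS.isPositive.isSymmetric (J.toMap e) e
  rw [hS.apply_conj he, he, inner_smul_left, inner_smul_right, Complex.conj_ofReal] at h
  have h1 : ((1 - s : ℝ) - s : ℂ) * ⟪J.toMap e, e⟫_ℂ = 0 := by rw [sub_mul, h, sub_self]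
  refine (mul_eq_zero.1 h1).resolve_left fun h2 => hs ?_
  have h3 : (1 - s) - s = 0 := by exact_mod_cast h2
  linarith

theorem eigenvalue_mem (hS : IsCovarianceOperator J S) {e : K} {s : ℝ}
    (he : S e = (s : ℂ) • e) (hn : ⟪e, e⟫_ℂ = 1) : 0 ≤ s ∧ s ≤ 1 := by
  have h1 := hS.isPositive.re_inner_nonneg_right e
  have h2 := hS.one_sub_isPositive.re_inner_nonneg_right e
  rw [LinearMap.sub_apply, Module.End.one_apply, inner_sub_right, he, inner_smul_right, hn] at h2
  rw [he, inner_smul_right, hn] at h1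
  simp at h1 h2
  exact ⟨h1, h2⟩

/-- Away from eigenvalue `1/2` isotropy is automatic. If `1/2` is the only eigenvalue inside `(0,
1)`, even dimension forces multiplicity at least two, and a symmetric complex bilinear form on a
plane has an isotropic vector. -/
theorem exists_isotropic_eigenvector [FiniteDimensional ℂ K] (hS : IsCovarianceOperator J S)
    (hK : Even (Module.finrank ℂ K)) (h : S * S ≠ S) :
    ∃ (e : K) (s : ℝ), 0 < s ∧ s < 1 ∧ ⟪e, e⟫_ℂ = 1 ∧ ⟪J.toMap e, e⟫_ℂ = 0 ∧
      S e = (s : ℂ) • e := by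
  classical
  have hsym := hS.isPositive.isSymmetric
  set b := hsym.eigenvectorBasis rfl with hb
  set c := hsym.eigenvalues rfl with hc
  have hbc : ∀ i, S (b i) = (c i : ℂ) • b i := fun i => hsym.apply_eigenvectorBasis rfl i
  have hon : ∀ i j, ⟪b i, b j⟫_ℂ = if i = j then 1 else 0 := orthonormal_iff_ite.1 b.orthonormal
  have hmem : ∀ i, 0 ≤ c i ∧ c i ≤ 1 := fun i => hS.eigenvalue_mem (hbc i) (by simp)
  by_cases h1 : ∃ i, c i ≠ 0 ∧ c i ≠ 1 ∧ c i ≠ 1 / 2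
  · obtain ⟨i, h0, h1, h2⟩ := h1
    exact ⟨b i, c i, lt_of_le_of_ne (hmem i).1 h0.symm, lt_of_le_of_ne (hmem i).2 h1,
      by simp, hS.inner_conj_eq_zero (hbc i) h2, hbc i⟩
  have h2 : ∀ i, c i = 0 ∨ c i = 1 ∨ c i = 1 / 2 := by
    intro i
    by_contra! h3
    exact h1 ⟨i, h3⟩
  clear h1
  have hex : ∃ i, c i = 1 / 2 := by
    by_contra! h3
    refine h (b.toBasis.ext fun i => ?_)
    rw [OrthonormalBasis.coe_toBasis, Module.End.mul_apply, hbc, map_smul, hbc, smul_smul]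
    rcases h2 i with h4 | h4 | h4
    · rw [h4]; simp
    · rw [h4]; simp
    · exact absurd h4 (h3 i)
  obtain ⟨i, hi⟩ := hex
  have hex2 : ∃ j, j ≠ i ∧ c j = 1 / 2 := by
    -- Comparing traces in `b` and its conjugate gives `dim K = 2 tr S`. A single eigenvalue `1/2`
    -- among zeros and ones would make this odd.
    by_contra! h3
    obtain ⟨b', hb'⟩ := J.exists_orthonormalBasis b
    have t1 := LinearMap.trace_eq_sum_inner S b
    rw [LinearMap.trace_eq_sum_inner S b'] at t1
    simp only [hb', hS.apply_conj (hbc _), hbc, inner_smul_right, J.inner_map_map, hon,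
      if_true, mul_one] at t1
    have t2 : ∑ j, (1 - c j) = ∑ j, c j := by exact_mod_cast t1
    have t3 : ∀ j, 2 * c j = ((2 * (if c j = 1 then 1 else 0) + (if j = i then 1 else 0) : ℕ) : ℝ) := by
      intro j
      by_cases hji : j = i
      · subst hji; rw [hi]; norm_num
      · rcases h2 j with h4 | h4 | h4
        · simp [h4, hji]
        · simp [h4, hji]
        · exact absurd h4 (h3 j hji)
    have t4 : ((Module.finrank ℂ K : ℕ) : ℝ) = ∑ j, 2 * c j := by
      rw [Finset.sum_sub_distrib] at t2
      rw [← Finset.mul_sum]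
      simp at t2
      linarith
    simp only [t3] at t4
    rw [← Nat.cast_sum, Nat.cast_inj, Finset.sum_add_distrib, ← Finset.mul_sum] at t4
    simp only [Finset.sum_ite_eq', Finset.mem_univ, if_true] at t4
    obtain ⟨m, hm⟩ := hK
    omega
  obtain ⟨j, hji, hj⟩ := hex2
  obtain ⟨z, hz0, hz1, hz2⟩ : ∃ z : K, z ≠ 0 ∧ ⟪J.toMap z, z⟫_ℂ = 0 ∧
      S z = ((1 / 2 : ℝ) : ℂ) • z := by
    by_cases hy : ⟪J.toMap (b j), b j⟫_ℂ = 0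
    · exact ⟨b j, b.orthonormal.ne_zero j, hy, by rw [hbc, hj]⟩
    -- Isotropy of `b i + t • b j` is a quadratic equation in `t`, solved with a root `w` of its
    -- discriminant.
    · obtain ⟨w, hw⟩ := IsAlgClosed.exists_pow_nat_eq
        (discrim ⟪J.toMap (b j), b j⟫_ℂ (2 * ⟪J.toMap (b i), b j⟫_ℂ) ⟪J.toMap (b i), b i⟫_ℂ)
        (n := 2) two_pos
      obtain ⟨t, ht⟩ := exists_quadratic_eq_zero hy ⟨w, by rw [← hw, sq]⟩
      refine ⟨b i + t • b j, fun h0 => ?_, ?_, ?_⟩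
      · have := congrArg (fun x => ⟪b i, x⟫_ℂ) h0
        simp [hon, hji.symm] at this
      · rw [map_add, map_smulₛₗ, inner_add_left, inner_add_right, inner_add_right,
          inner_smul_left, inner_smul_left, inner_smul_right, inner_smul_right,
          J.inner_map_left (b j) (b i), Complex.conj_conj, ← ht]
        ring
      · rw [map_add, map_smul, hbc, hbc, hi, hj]
        module
  have hnz : (‖z‖ : ℂ) ≠ 0 := by simpa using hz0
  refine ⟨(‖z‖ : ℂ)⁻¹ • z, 1 / 2, by norm_num, by norm_num, ?_, ?_, ?_⟩
  · rw [inner_smul_left, inner_smul_right, inner_self_eq_norm_sq_to_K, map_inv₀,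
      Complex.conj_ofReal]
    simp only [Complex.coe_algebraMap]
    field_simp
  · rw [map_smulₛₗ, inner_smul_left, inner_smul_right, hz1, mul_zero, mul_zero]
  · rw [map_smul, hz2, smul_comm]

end IsCovarianceOperator

/-- The operator `|e⟩⟨e| - |J e⟩⟨J e|`. -/
def modeShift (J : Conjugation K) (e : K) : K →ₗ[ℂ] K :=
  (innerSL ℂ e).toLinearMap.smulRight e
    - (innerSL ℂ (J.toMap e)).toLinearMap.smulRight (J.toMap e)

theorem modeShift_apply (J : Conjugation K) (e x : K) :
    modeShift J e x = ⟪e, x⟫_ℂ • e - ⟪J.toMap e, x⟫_ℂ • J.toMap e := rfl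

theorem modeShift_conj (J : Conjugation K) (e x : K) :
    J.toMap (modeShift J e (J.toMap x)) = - modeShift J e x := by
  rw [modeShift_apply, modeShift_apply, map_sub, map_smulₛₗ, map_smulₛₗ, J.involutive,
    inner_conj_symm, inner_conj_symm, J.inner_map_left x e, J.inner_map_map]
  abel

theorem pairing_modeShift (J : Conjugation K) (e f : K) :
    pairing J (modeShift J e) f = (innerSL ℂ (J.toMap e)).toLinearMap f • (innerSL ℂ e).toLinearMap
      - (innerSL ℂ e).toLinearMap f • (innerSL ℂ (J.toMap e)).toLinearMap := by
  ext x
  rw [pairing_apply, modeShift_apply, inner_sub_right, inner_smul_right, inner_smul_right,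
    J.inner_map_left f e, J.inner_map_map]
  simp
  ring

theorem pairing_add_smul (J : Conjugation K) (S T : K →ₗ[ℂ] K) (c : ℂ) (f : K) :
    pairing J (S + c • T) f = pairing J S f + c • pairing J T f := by
  ext x
  simp

namespace IsCovarianceOperator

variable {J : Conjugation K} {S : K →ₗ[ℂ] K}

/-- The shift moves the eigenvalues `s` at `e` and `1 - s` at `J e` to `s + c` and `1 - s - c`, and
changes nothing on the orthogonal complement. -/
theorem add_modeShift (hS : IsCovarianceOperator J S) {e : K} {s c : ℝ} (hn : ⟪e, e⟫_ℂ = 1)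
    (hJ : ⟪J.toMap e, e⟫_ℂ = 0) (he : S e = (s : ℂ) • e) (h0 : 0 ≤ s + c) (h1 : s + c ≤ 1) :
    IsCovarianceOperator J (S + (c : ℂ) • modeShift J e) := by
  have hsym := hS.isPositive.isSymmetric
  have hn' : ⟪J.toMap e, J.toMap e⟫_ℂ = 1 := by rw [J.inner_map_map, hn]
  have hJ' : ⟪e, J.toMap e⟫_ℂ = 0 := by rw [← inner_conj_symm, hJ, map_zero]
  refine of_isPositive ⟨fun x y => ?_, fun x => ?_⟩ fun f => ?_
  · simp only [LinearMap.add_apply, LinearMap.smul_apply, modeShift_apply, inner_add_left,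
      inner_add_right, inner_sub_left, inner_sub_right, inner_smul_left, inner_smul_right, hsym x y,
      inner_conj_symm, Complex.conj_ofReal]
    ring
  -- With `y` the component of `x` orthogonal to `e` and `J e`, the new form at `x` is `⟪y, S y⟫ +
  -- (s + c)|⟪e, x⟫|² + (1 - s - c)|⟪J e, x⟫|²`.
  · have hy := hS.isPositive.re_inner_nonneg_right
      (x - ⟪e, x⟫_ℂ • e - ⟪J.toMap e, x⟫_ℂ • J.toMap e)
    have k1 : ⟪e, S x⟫_ℂ = s * ⟪e, x⟫_ℂ := by
      rw [← hsym, he, inner_smul_left, Complex.conj_ofReal]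
    have k2 : ⟪J.toMap e, S x⟫_ℂ = (1 - s) * ⟪J.toMap e, x⟫_ℂ := by
      rw [← hsym, hS.apply_conj he, inner_smul_left, Complex.conj_ofReal]
      push_cast; rfl
    have n1 : ∀ u : K, ⟪x, u⟫_ℂ = starRingEnd ℂ ⟪u, x⟫_ℂ := fun u => (inner_conj_symm x u).symm
    have q : ∀ w : ℂ, starRingEnd ℂ w * w = ((Complex.normSq w : ℝ) : ℂ) := fun w => by
      rw [mul_comm, Complex.mul_conj]
    have expand : ⟪x - ⟪e, x⟫_ℂ • e - ⟪J.toMap e, x⟫_ℂ • J.toMap e,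
        S (x - ⟪e, x⟫_ℂ • e - ⟪J.toMap e, x⟫_ℂ • J.toMap e)⟫_ℂ = ⟪x, S x⟫_ℂ
        - ((s * Complex.normSq ⟪e, x⟫_ℂ + (1 - s) * Complex.normSq ⟪J.toMap e, x⟫_ℂ : ℝ) : ℂ) := by
      simp only [map_sub, map_smul, he, hS.apply_conj he, inner_sub_left, inner_sub_right,
        inner_smul_left, inner_smul_right, hn, hn', hJ, hJ', k1, k2, n1 e, n1 (J.toMap e)]
      push_cast
      rw [← q, ← q]
      ring
    have expand2 : ⟪(S + (c : ℂ) • modeShift J e) x, x⟫_ℂ = ⟪S x, x⟫_ℂ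
        + ((c * (Complex.normSq ⟪e, x⟫_ℂ - Complex.normSq ⟪J.toMap e, x⟫_ℂ) : ℝ) : ℂ) := by
      rw [LinearMap.add_apply, LinearMap.smul_apply, modeShift_apply, inner_add_left,
        inner_smul_left, inner_sub_left, inner_smul_left, inner_smul_left, Complex.conj_ofReal,
        q, q]
      push_cast
      ring
    rw [expand, map_sub] at hy
    rw [expand2, map_add, hsym]
    simp only [RCLike.re_to_complex, Complex.ofReal_re] at hy ⊢
    have a1 := mul_nonneg h0 (Complex.normSq_nonneg ⟪e, x⟫_ℂ)
    have a2 := mul_nonneg (sub_nonneg.2 h1) (Complex.normSq_nonneg ⟪J.toMap e, x⟫_ℂ)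
    nlinarith
  · rw [LinearMap.add_apply, LinearMap.smul_apply, LinearMap.add_apply, LinearMap.smul_apply,
      map_add, map_smulₛₗ, modeShift_conj, Complex.conj_ofReal]
    conv_rhs => rw [← hS.add_conj f]
    module

/-- Makes the induction in `exists_implements` terminate. The old kernel is orthogonal to `e` and `J
e`, where `S - S²` has the nonzero eigenvalue `s - s²`, so the shift does not affect it; the new
kernel also contains `e`. -/
theorem ker_lt (hS : IsCovarianceOperator J S) {e : K} {s c : ℝ} (hn : ⟪e, e⟫_ℂ = 1)
    (hJ : ⟪J.toMap e, e⟫_ℂ = 0) (he : S e = (s : ℂ) • e) (h0 : 0 < s) (h1 : s < 1)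
    (hc : s + c = 0 ∨ s + c = 1) :
    LinearMap.ker (S - S * S) < LinearMap.ker ((S + (c : ℂ) • modeShift J e)
      - (S + (c : ℂ) • modeShift J e) * (S + (c : ℂ) • modeShift J e)) := by
  have hsym := hS.isPositive.isSymmetric
  have hss : (s : ℂ) - s * s ≠ 0 := by
    have : s - s * s ≠ 0 := by nlinarith
    exact_mod_cast this
  have orth : ∀ (g : K) (r : ℝ), S g = (r : ℂ) • g → (r : ℂ) - r * r = s - s * s → ∀ x, S x = S (S x) →
      ⟪g, x⟫_ℂ = 0 ∧ ⟪g, S x⟫_ℂ = 0 := by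
    intro g r hg hr x hx
    have k : ∀ x, ⟪g, S x⟫_ℂ = r * ⟪g, x⟫_ℂ := fun x => by
      rw [← hsym, hg, inner_smul_left, Complex.conj_ofReal]
    have h2 : ((r : ℂ) - r * r) * ⟪g, x⟫_ℂ = 0 := by
      rw [sub_mul, mul_assoc, ← k, ← k, ← hx, sub_self]
    rw [hr] at h2
    have h3 := (mul_eq_zero.1 h2).resolve_left hss
    exact ⟨h3, by rw [k, h3, mul_zero]⟩
  rw [SetLike.lt_iff_le_and_exists]
  constructor
  · intro x hx
    rw [LinearMap.mem_ker, LinearMap.sub_apply, Module.End.mul_apply, sub_eq_zero] at hx ⊢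
    obtain ⟨a1, a2⟩ := orth e s he rfl x hx
    obtain ⟨a3, a4⟩ := orth (J.toMap e) (1 - s) (hS.apply_conj he) (by push_cast; ring) x hx
    simp only [LinearMap.add_apply, LinearMap.smul_apply, modeShift_apply, a1, a2, a3, a4,
      zero_smul, sub_zero, smul_zero, add_zero]
    exact hx
  · refine ⟨e, ?_, ?_⟩
    · have : (S + (c : ℂ) • modeShift J e) e = ((s + c : ℝ) : ℂ) • e := by
        rw [LinearMap.add_apply, LinearMap.smul_apply, modeShift_apply, hn, hJ, he]
        push_cast
        module
      rw [LinearMap.mem_ker, LinearMap.sub_apply, Module.End.mul_apply, sub_eq_zero, this,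
        map_smul, this]
      rcases hc with hc | hc <;> simp [hc]
    · rw [LinearMap.mem_ker, LinearMap.sub_apply, Module.End.mul_apply, he, map_smul, he, smul_smul,
        ← sub_smul]
      intro h
      rcases smul_eq_zero.1 h with h | h
      · exact hss h
      · rw [h] at hn
        simp at hn

end IsCovarianceOperator

end Covariance

/-! ### Constructing implementing elements. -/

section Implementers

variable {A : Type*} [Ring A] [Algebra ℂ A] [StarRing A] [StarModule ℂ A]

omit [StarModule ℂ A] in
theorem Implements.isState {τ : A →ₗ[ℂ] ℂ} (hτ : IsFaithfulTrace τ) {V : A} {ω : A →ₗ[ℂ] ℂ}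
    (hV : Implements τ V ω) (h1 : ω 1 = 1) : IsState ω := by
  refine ⟨fun a => ?_, h1⟩
  rw [hV, show star V * (star a * a * V) = star (a * V) * (a * V) by
    rw [star_mul]; simp only [mul_assoc]]
  exact hτ.nonneg _

omit [StarModule ℂ A] in
-- `ω (star a * a)` is the squared trace norm of `a * V`, and the trace is faithful.
theorem Implements.mul_eq_zero {τ : A →ₗ[ℂ] ℂ} (hτ : IsFaithfulTrace τ) {V : A} {ω : A →ₗ[ℂ] ℂ}
    (hV : Implements τ V ω) {a : A} (h : ω (star a * a) = 0) : a * V = 0 := by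
  apply hτ.eq_zero
  rw [← h, hV, star_mul]
  simp only [mul_assoc]

/-- `p` divided by the square root of `τ p` works, since `p a p = ω a • p`. -/
theorem implements_of_projection {τ : A →ₗ[ℂ] ℂ} (hτ : IsFaithfulTrace τ) {p : A} {ω : A →ₗ[ℂ] ℂ}
    (hp : star p = p) (hpp : p * p = p) (h0 : p ≠ 0) (h : ∀ x, p * x * p = ω x • p) :
    ∃ W, star W = W ∧ Implements τ W ω := by
  have h1 : 0 ≤ τ p := by simpa [hp, hpp] using hτ.nonneg p
  have h2 : τ p ≠ 0 := fun h3 => h0 (hτ.eq_zero p (by rw [hp, hpp, h3]))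
  obtain ⟨r, hr, hrp⟩ : ∃ r : ℝ, 0 ≤ r ∧ (r : ℂ) = τ p :=
    ⟨_, (Complex.nonneg_iff.1 h1).1, Complex.ext rfl (Complex.nonneg_iff.1 h1).2⟩
  have hr0 : r ≠ 0 := fun h => h2 (by rw [← hrp, h]; simp)
  have hc : starRingEnd ℂ ((Real.sqrt r)⁻¹ : ℝ) = ((Real.sqrt r)⁻¹ : ℝ) := Complex.conj_ofReal _
  refine ⟨(((Real.sqrt r)⁻¹ : ℝ) : ℂ) • p, ?_, fun a => ?_⟩
  · rw [star_smul, hp]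
    exact congrArg (· • p) hc
  · have hsq : (((Real.sqrt r)⁻¹ : ℝ) : ℂ) * (((Real.sqrt r)⁻¹ : ℝ) : ℂ) * r = 1 := by
      rw [← Complex.ofReal_mul, ← Complex.ofReal_mul, ← mul_inv, Real.mul_self_sqrt hr,
        inv_mul_cancel₀ hr0, Complex.ofReal_one]
    rw [star_smul, hp, mul_smul_comm, mul_smul_comm, smul_mul_assoc, ← mul_assoc, h, map_smul,
      map_smul, map_smul, ← hrp, smul_eq_mul, smul_eq_mul, smul_eq_mul]
    have : (star (((Real.sqrt r)⁻¹ : ℝ) : ℂ)) = (((Real.sqrt r)⁻¹ : ℝ) : ℂ) := hc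
    rw [this]
    linear_combination (-ω a) * hsq

/-- The witness is `√(1 - s) W₀ + √s W₁`. By cyclicity only its square matters, and the cross terms
vanish there. -/
theorem implements_convex {τ : A →ₗ[ℂ] ℂ} (hτ : IsFaithfulTrace τ) {W₀ W₁ : A}
    {ω ω₀ ω₁ : A →ₗ[ℂ] ℂ} (h₀ : star W₀ = W₀) (h₁ : star W₁ = W₁) (i₀ : Implements τ W₀ ω₀)
    (i₁ : Implements τ W₁ ω₁) (h : W₀ * W₁ = 0) {s : ℝ} (s0 : 0 ≤ s) (s1 : s ≤ 1)
    (hω : ∀ x, ω x = (1 - s) * ω₀ x + s * ω₁ x) :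
    ∃ W, star W = W ∧ Implements τ W ω := by
  have h' : W₁ * W₀ = 0 := by
    have := congrArg star h
    rwa [star_mul, h₀, h₁, star_zero] at this
  have hc : ∀ r : ℝ, star (r : ℂ) = r := Complex.conj_ofReal
  have hW : star ((Real.sqrt (1 - s) : ℂ) • W₀ + (Real.sqrt s : ℂ) • W₁)
      = (Real.sqrt (1 - s) : ℂ) • W₀ + (Real.sqrt s : ℂ) • W₁ := by
    rw [star_add, star_smul, star_smul, h₀, h₁, hc, hc]
  refine ⟨_, hW, fun a => ?_⟩
  have q0 : (Real.sqrt (1 - s) : ℂ) * Real.sqrt (1 - s) = 1 - s := by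
    rw [← Complex.ofReal_mul, Real.mul_self_sqrt (sub_nonneg.2 s1)]
    push_cast; rfl
  have q1 : (Real.sqrt s : ℂ) * Real.sqrt s = s := by
    rw [← Complex.ofReal_mul, Real.mul_self_sqrt s0]
  have hsq : ((Real.sqrt (1 - s) : ℂ) • W₀ + (Real.sqrt s : ℂ) • W₁)
      * ((Real.sqrt (1 - s) : ℂ) • W₀ + (Real.sqrt s : ℂ) • W₁)
      = (1 - s : ℂ) • (W₀ * W₀) + (s : ℂ) • (W₁ * W₁) := by
    rw [add_mul, mul_add, mul_add, smul_mul_smul_comm, smul_mul_smul_comm, smul_mul_smul_comm,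
      smul_mul_smul_comm, h, h', smul_zero, smul_zero, q0, q1]
    abel
  have cyc : ∀ W : A, τ (W * (a * W)) = τ (a * (W * W)) := fun W => by
    rw [hτ.mul_comm, mul_assoc]
  rw [hW, cyc, hsq, mul_add, mul_smul_comm, mul_smul_comm, map_add, map_smul, map_smul, ← cyc,
    ← cyc, hω, i₀, i₁, h₀, h₁, smul_eq_mul, smul_eq_mul]

end Implementers

/-! ### Existence of implementers for all quasifree states. -/

section Existence

variable {K : Type*} [NormedAddCommGroup K] [InnerProductSpace ℂ K] [FiniteDimensional ℂ K]

omit [FiniteDimensional ℂ K] in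
-- `1 - 2P` is an involution. With the determinant formula at `S = P` this shows that the support
-- projection is nonzero.
theorem IsBasisProjection.norm_det {J : Conjugation K} {P : K →ₗ[ℂ] K}
    (hP : IsBasisProjection J P) : ‖LinearMap.det (1 - P - P)‖ = 1 := by
  have h : (1 - P - P) * (1 - P - P) = 1 := by
    have := hP.idempotent
    rw [mul_sub, sub_mul, sub_mul, mul_sub, mul_sub, sub_mul, sub_mul, this]
    simp
  have h2 := congrArg (fun T => ‖LinearMap.det T‖) h
  simp only [map_mul, norm_mul, map_one, norm_one] at h2
  nlinarith [norm_nonneg (LinearMap.det (1 - P - P))]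

/-- Quasifree states are implemented by selfadjoint elements. -/
theorem exists_implements {J : Conjugation K} (hK : Even (Module.finrank ℂ K))
    {τ : CAR J →ₗ[ℂ] ℂ} (hτ : IsFaithfulTrace τ) {S : K →ₗ[ℂ] K} (hS : IsCovarianceOperator J S) :
    ∃ W, star W = W ∧ Implements τ W (quasifreeState J hS) := by
  induction hk : Module.finrank ℂ K - Module.finrank ℂ (LinearMap.ker (S - S * S))
    using Nat.strong_induction_on generalizing S with
  | _ k ih =>
    by_cases h : S * S = S
    · have hQ : IsBasisProjection J S := ⟨hS, h⟩
      obtain ⟨p, hp, hpp, hx, hdet⟩ := hQ.exists_support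
      refine implements_of_projection hτ hp hpp (fun h0 => ?_) hx
      have := hdet S hS
      rw [hQ.norm_det, h0, map_zero] at this
      simp at this
    · obtain ⟨e, s, s0, s1, hn, hJ, he⟩ := hS.exists_isotropic_eigenvector hK h
      have hJ' : ⟪e, J.toMap e⟫_ℂ = 0 := by rw [← inner_conj_symm, hJ, map_zero]
      have hn' : ⟪J.toMap e, J.toMap e⟫_ℂ = 1 := by rw [J.inner_map_map, hn]
      have step : ∀ c : ℝ, s + c = 0 ∨ s + c = 1 → ∀ hc : IsCovarianceOperator J
          (S + (c : ℂ) • modeShift J e), ∃ W, star W = W ∧ Implements τ W (quasifreeState J hc) := by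
        intro c hsc hc
        refine ih _ ?_ hc rfl
        have h1 := Submodule.finrank_lt_finrank_of_lt (hS.ker_lt hn hJ he s0 s1 hsc)
        have h2 := Submodule.finrank_le (LinearMap.ker ((S + (c : ℂ) • modeShift J e)
          - (S + (c : ℂ) • modeShift J e) * (S + (c : ℂ) • modeShift J e)))
        omega
      have hS₀ := hS.add_modeShift (c := -s) hn hJ he (by simp) (by simp)
      have hS₁ := hS.add_modeShift (c := 1 - s) hn hJ he (by simp) (by simp)
      obtain ⟨W₀, a₀, i₀⟩ := step (-s) (by simp) hS₀
      obtain ⟨W₁, a₁, i₁⟩ := step (1 - s) (by simp) hS₁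
      -- The mode `e` has eigenvalue `0` in the first state and `1` in the second, so `B e` kills
      -- `W₀` and `B (J e)` kills `W₁`. Inserting `1 = B e B (J e) + B (J e) B e` between them gives
      -- `W₀ * W₁ = 0`.
      have z₀ : field J e * W₀ = 0 := by
        refine i₀.mul_eq_zero hτ ?_
        rw [star_field, quasifreeState_field_mul_field, J.involutive, LinearMap.add_apply,
          LinearMap.smul_apply, modeShift_apply, hn, hJ, he]
        simp
      have z₀' : W₀ * field J (J.toMap e) = 0 := by
        have := congrArg star z₀
        rwa [star_mul, star_field, a₀, star_zero] at this
      have z₁ : field J (J.toMap e) * W₁ = 0 := by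
        refine i₁.mul_eq_zero hτ ?_
        rw [star_field, quasifreeState_field_mul_field, LinearMap.add_apply,
          LinearMap.smul_apply, modeShift_apply, hn', hJ', hS.apply_conj he]
        simp
      have hanti := field_anticomm J e (J.toMap e)
      rw [hn', map_one] at hanti
      have h01 : W₀ * W₁ = 0 := by
        rw [← one_mul W₁, ← hanti, add_mul, mul_add, mul_assoc (field J e), z₁, mul_zero, mul_zero,
          zero_add, mul_assoc (field J _), ← mul_assoc W₀, z₀', zero_mul]
      refine implements_convex hτ a₀ a₁ i₀ i₁ h01 s0.le s1.le fun x => ?_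
      refine quasifreeState_affine J hS hS₀ hS₁ s (innerSL ℂ (J.toMap e)).toLinearMap
        (innerSL ℂ e).toLinearMap (fun f => ?_) (fun f => ?_) x
      · rw [← pairing_modeShift, pairing_add_smul]
        push_cast
        module
      · rw [← pairing_modeShift, pairing_add_smul, pairing_add_smul]
        push_cast
        module

end Existence

/-! ### Cauchy–Schwarz for the trace and the optimal overlap. -/

section Overlap

variable {A : Type*} [Ring A] [Algebra ℂ A] [StarRing A] [StarModule ℂ A]

/-- Polarization: the trace is real on squares of `a + b` and `a + I • b`. -/
theorem IsFaithfulTrace.map_star_mul {τ : A →ₗ[ℂ] ℂ} (hτ : IsFaithfulTrace τ) (a b : A) :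
    τ (star b * a) = starRingEnd ℂ (τ (star a * b)) := by
  have im0 : ∀ x, (τ (star x * x)).im = 0 := fun x => (Complex.nonneg_iff.1 (hτ.nonneg x)).2.symm
  have h1 := im0 (a + b)
  have h2 := im0 (a + Complex.I • b)
  have hI : star Complex.I = -Complex.I := Complex.conj_I
  simp only [star_add, star_smul, add_mul, mul_add, mul_smul_comm, smul_mul_assoc, map_add,
    map_smul, hI, smul_eq_mul, Complex.add_im, Complex.mul_im, Complex.neg_re, Complex.neg_im,
    Complex.I_re, Complex.I_im, Complex.mul_re, im0] at h1 h2
  apply Complex.ext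
  · rw [Complex.conj_re]; linarith
  · rw [Complex.conj_im]; linarith

/-- Cauchy–Schwarz, from positivity at `y - c • V`. -/
theorem IsFaithfulTrace.norm_map_star_mul_le {τ : A →ₗ[ℂ] ℂ} (hτ : IsFaithfulTrace τ) {V : A}
    (hV : τ (star V * V) = 1) (y : A) : ‖τ (star V * y)‖ ^ 2 ≤ (τ (star y * y)).re := by
  set c := τ (star V * y) with hc
  have h := (Complex.nonneg_iff.1 (hτ.nonneg (y - c • V))).1
  have hs : star c = starRingEnd ℂ c := rfl
  have hyV : τ (star y * V) = starRingEnd ℂ c := hτ.map_star_mul V y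
  simp only [star_sub, star_smul, sub_mul, mul_sub, mul_smul_comm, smul_mul_assoc, map_sub,
    map_smul, smul_eq_mul, hV, hyV, ← hc, hs, mul_one, Complex.sub_re, sub_self,
    mul_zero, Complex.zero_re] at h
  have q : (starRingEnd ℂ c * c).re = ‖c‖ ^ 2 := by
    rw [Complex.conj_mul', ← Complex.ofReal_pow, Complex.ofReal_re]
  linarith

/-- The overlaps with a pure state, supported on the minimal projection `p`, have a maximum, the
square root of the value of the other state on `p`. -/
theorem isGreatest_overlaps {τ ω φ : A →ₗ[ℂ] ℂ} (hτ : IsFaithfulTrace τ) {p : A}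
    (hp : star p = p) (hpp : p * p = p) (hω : ∀ x, p * x * p = ω x • p) {V₀ W : A}
    (hV₀ : Implements τ V₀ ω) (hW : Implements τ W φ) (hω1 : ω 1 = 1) (hp0 : p ≠ 0) :
    IsGreatest (overlaps τ ω φ) (Real.sqrt ‖φ p‖) := by
  have hωp : ω p = 1 := by
    have := hω p
    rw [hpp, hpp] at this
    by_contra h
    have h2 : (1 - ω p) • p = 0 := by rw [sub_smul, one_smul, ← this, sub_self]
    rcases smul_eq_zero.1 h2 with h3 | h3
    · exact h (sub_eq_zero.1 h3).symm
    · exact hp0 h3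
  have hφ : ∀ {W}, Implements τ W φ → φ p = τ (star (p * W) * (p * W)) := fun {W} hW => by
    rw [hW, star_mul, hp, mul_assoc, ← mul_assoc p p, hpp]
  have hφ0 : 0 ≤ φ p := hφ hW ▸ hτ.nonneg _
  have hφr : (φ p).re = ‖φ p‖ := by
    rw [← Complex.re_eq_norm.2 hφ0]
  -- `ω (1 - p) = 0`, so `1 - p` annihilates every implementer of `ω`.
  have hpV : ∀ {V}, Implements τ V ω → p * V = V := fun {V} hV => by
    have := hV.mul_eq_zero hτ (a := 1 - p) (by
      rw [star_sub, star_one, hp, mul_sub, mul_one, sub_mul, one_mul, hpp, sub_self, sub_zero,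
        map_sub, hω1, hωp, sub_self])
    rw [sub_mul, one_mul, sub_eq_zero] at this
    exact this.symm
  have hnorm : ∀ {V}, Implements τ V ω → τ (star V * V) = 1 := fun {V} hV => by
    rw [← hω1, hV, one_mul]
  constructor
  · by_cases h0 : φ p = 0
    -- Here `p * W = 0` cannot be normalized, but every implementer of `ω` gives overlap zero with
    -- `W`.
    · refine ⟨V₀, W, hV₀, hW, ?_⟩
      have : p * W = 0 := hτ.eq_zero _ (by rw [← hφ hW, h0])
      rw [h0, ← hpV hV₀, star_mul, hp, mul_assoc, this]
      simp
    · set r := ‖φ p‖ with hr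
      have hr0 : r ≠ 0 := norm_ne_zero_iff.2 h0
      have hrp : φ p = (r : ℂ) := by
        rw [← hφr]
        exact Complex.ext rfl (Complex.nonneg_iff.1 hφ0).2.symm
      have hc : ∀ x : ℝ, star (x : ℂ) = x := Complex.conj_ofReal
      have hsq : (((Real.sqrt r)⁻¹ : ℝ) : ℂ) * (((Real.sqrt r)⁻¹ : ℝ) : ℂ) * r = 1 := by
        rw [← Complex.ofReal_mul, ← Complex.ofReal_mul, ← mul_inv,
          Real.mul_self_sqrt (norm_nonneg _), inv_mul_cancel₀ hr0, Complex.ofReal_one]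
      have hcyc : ∀ a, τ (star (p * W) * (a * (p * W))) = ω a * r := fun a => by
        have e1 : star (p * W) * (a * (p * W)) = star W * ((p * a * p) * W) := by
          rw [star_mul, hp]
          simp only [mul_assoc]
        rw [e1, hω, smul_mul_assoc, mul_smul_comm, map_smul, ← hW, hrp, smul_eq_mul]
      refine ⟨(((Real.sqrt r)⁻¹ : ℝ) : ℂ) • (p * W), W, fun a => ?_, hW, ?_⟩
      · rw [star_smul, hc, mul_smul_comm, mul_smul_comm, smul_mul_assoc, map_smul, map_smul, hcyc,
          smul_eq_mul, smul_eq_mul]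
        linear_combination (-ω a) * hsq
      · have e2 : star (p * W) * W = star W * (p * W) := by rw [star_mul, hp, mul_assoc]
        rw [star_smul, hc, smul_mul_assoc, map_smul, e2, ← hW, hrp, smul_eq_mul,
          ← Complex.ofReal_mul, Complex.norm_real, Real.norm_eq_abs, abs_of_nonneg]
        · rw [← div_eq_inv_mul, Real.div_sqrt]
        · exact mul_nonneg (inv_nonneg.2 (Real.sqrt_nonneg _)) (norm_nonneg _)
  · rintro _ ⟨V, W, hV, hW, rfl⟩
    apply Real.le_sqrt_of_sq_le
    have h1 : star V * W = star V * (p * W) := by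
      nth_rewrite 1 [← hpV hV]
      rw [star_mul, hp, mul_assoc]
    rw [h1, ← hφr, hφ hW]
    exact hτ.norm_map_star_mul_le (hnorm hV) _

end Overlap

end SelfDualCAR

end

open SelfDualCAR
theorem mainTheorem1 {K : Type*} [NormedAddCommGroup K] [InnerProductSpace ℂ K]
    [FiniteDimensional ℂ K] (J : Conjugation K) (P S : K →ₗ[ℂ] K)
    (hP : IsBasisProjection J P) (hS : IsCovarianceOperator J S)
    (τ : CAR J →ₗ[ℂ] ℂ) (hτ : IsFaithfulTrace τ) :
    IsState (quasifreeState J hP.toIsCovarianceOperator) ∧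
    IsState (quasifreeState J hS) ∧
    IsLUB (overlaps τ (quasifreeState J hP.toIsCovarianceOperator) (quasifreeState J hS))
      (fidelity τ (quasifreeState J hP.toIsCovarianceOperator) (quasifreeState J hS)) ∧
    fidelity τ (quasifreeState J hP.toIsCovarianceOperator) (quasifreeState J hS) ^ 2 =
      ‖LinearMap.det (1 - P - S)‖ ^ (1 / 2 : ℝ) := by
  -- The range of `P` and its conjugate have the same dimension and together fill `K`.
  have hK : Even (Module.finrank ℂ K) := by
    obtain ⟨n, e, b, -⟩ := hP.exists_orthonormalBasis
    exact ⟨n, by simpa using Module.finrank_eq_card_basis b.toBasis⟩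
  obtain ⟨V, -, hV⟩ := exists_implements hK hτ hP.toIsCovarianceOperator
  obtain ⟨W, -, hW⟩ := exists_implements hK hτ hS
  obtain ⟨p, hp, hpp, hω, hdet⟩ := hP.exists_support
  have hp0 : p ≠ 0 := fun h0 => by
    have := hdet P hP.toIsCovarianceOperator
    rw [hP.norm_det, h0, map_zero] at this
    simp at this
  have hmax := isGreatest_overlaps hτ hp hpp hω hV hW (quasifreeState_one J _) hp0
  have hF : fidelity τ (quasifreeState J hP.toIsCovarianceOperator) (quasifreeState J hS)
      = Real.sqrt ‖quasifreeState J hS p‖ := hmax.csSup_eq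
  refine ⟨hV.isState hτ (quasifreeState_one J _), hW.isState hτ (quasifreeState_one J _),
    hF ▸ hmax.isLUB, ?_⟩
  rw [hF, Real.sq_sqrt (norm_nonneg _), ← hdet S hS, ← Real.sqrt_eq_rpow,
    Real.sqrt_sq (norm_nonneg _)]
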